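/- Let $N=n+1\ge 1$, let $\Gamma\subseteq\mathbb R^{N-1}$ be a non-empty bounded connected open set, let $\Omega=\Gamma\times(-1,1)$, $\Omega_1=\Gamma\times(-1,0)$, $\Omega_2=\Gamma\times(0,1)$, and write points of $\Omega$ as $X=(\widetilde X,X_N)$. Let $\zeta$ be a piecewise $C^1$ perturbation of the interface: $\zeta\in C(\overline\Gamma)$, $\zeta=0$ on $\partial\Gamma$, $-1<\zeta<1$ on $\Gamma$, and $\zeta$ is piecewise $C^1$ with bounded gradient. Here piecewise $C^1$ means that there are finitely many pairwise disjoint open sets $U_j\subseteq\Gamma$ whose union has full measure in $\Gamma$ and such that on each $U_j$ the function $\zeta$ coincides with a function of class $C^1(\Gamma)$. Put $$\|\zeta\|_{\infty}=\operatorname{ess\,sup}_{\Gamma}|\zeta|,\qquad \|\zeta\|_{W^{1,\infty}(\Gamma)}=\|\zeta\|_{\infty}+\operatorname{ess\,sup}_{\Gamma}|\nabla\zeta|,\qquad C_\zeta=\sqrt{\max\{2,\,4\|\zeta\|_{W^{1,\infty}(\Gamma)}^2\}} .$$ Let $\Omega_1^\zeta=\{X\in\Omega: X_N<\zeta(\widetilde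 X)\}$, $\Omega_2^\zeta=\{X\in\Omega: X_N>\zeta(\widetilde X)\}$, and let $\Lambda_i:\Omega_i^\zeta\to\Omega_i$ be the bijections $$\Lambda_i(\widetilde X,X_N)=\Big(\widetilde X,\ \frac{X_N-\zeta(\widetilde X)}{1-(-1)^i\zeta(\widetilde X)}\Big),\qquad \Lambda_i^{-1}(\widetilde x,z)=\big(\widetilde x,\ z\,(1-(-1)^i\zeta(\widetilde x))+\zeta(\widetilde x)\big),\qquad i=1,2 .$$ Theorem. The fractional mapping operator $$T r=\sum_{i=1,2}\big(r\circ\Lambda_i^{-1}\big)\,\mathbf 1_{\Omega_i},\qquad r\in H^1(\Omega),$$ is well defined on almost-everywhere classes and is an isomorphism of $H^1(\Omega)$ onto itself, that is, a bounded linear bijection with bounded inverse. Moreover $\|\zeta\|_\infty<1$ and $$\|T r\|_{1,\Omega}\ \le\ \frac{C_\zeta}{\sqrt{1-\|\zeta\|_{\infty}}}\ \|r\|_{1,\Omega}\qquad\text{for all } r\in H^1(\Omega),$$ where $\|r\|_{1,\Omega}^2=\|r\|_{L^2(\Omega)}^2+\sum_{l=1}^N\|\partial_l r\|_{L^2(\Omega)}^2$.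 -/

import Mathlib

open MeasureTheory Set
open scoped ContDiff Gradient

noncomputable section

namespace FractionalMapping

/-- Points of `ℝ^N`, `N = n + 1`, written `X = (X̃, X_N)` with `X̃ ∈ ℝ^(N-1)` and `X_N ∈ ℝ`.
The volume of this type is the `N`-dimensional Lebesgue measure. -/
abbrev Space (n : ℕ) : Type := EuclideanSpace ℝ (Fin n) × ℝ

/-- The canonical basis `ê_1, …, ê_N` of `ℝ^N`: the horizontal unit vectors, then `(0, 1)`. -/
def basisVec {n : ℕ} (l : Fin (n + 1)) : Space n :=
  Fin.lastCases (0, 1) (fun j => (EuclideanSpace.single j 1, 0)) l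

/-! ### The Sobolev space `H¹(Ω)` -/

/-- `g` is the weak derivative of `u` on the open set `Ω` in the direction `v`:
`∫_Ω u ∂_v φ = - ∫_Ω g φ` for all `φ ∈ C_0^∞(Ω)`. -/
def IsWeakDeriv {n : ℕ} (Ω : Set (Space n)) (v : Space n) (u g : Space n → ℝ) : Prop :=
  ∀ φ : Space n → ℝ, ContDiff ℝ ∞ φ → HasCompactSupport φ → tsupport φ ⊆ Ω →
    ∫ x in Ω, u x * fderiv ℝ φ x v = - ∫ x in Ω, g x * φ x

/-- The real Hilbert space `L²(Ω)`. -/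
abbrev L2 {n : ℕ} (Ω : Set (Space n)) : Type := Lp ℝ 2 (volume.restrict Ω)

theorem integrable_L2_mul {n : ℕ} {Ω : Set (Space n)} (u : L2 Ω) {ψ : Space n → ℝ}
    (hc : Continuous ψ) (hs : HasCompactSupport ψ) :
    Integrable (fun x => u x * ψ x) (volume.restrict Ω) :=
  (Lp.memLp u).integrable_mul (q := 2)
    ((hc.memLp_of_hasCompactSupport (p := 2) (μ := volume) hs).restrict Ω)

theorem hasCompactSupport_fderiv_apply {n : ℕ} {φ : Space n → ℝ} (hs : HasCompactSupport φ)
    (v : Space n) : HasCompactSupport (fun x => fderiv ℝ φ x v) :=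
  hs.fderiv_apply ℝ v

theorem IsWeakDeriv.add {n : ℕ} {Ω : Set (Space n)} {v : Space n} {u g u' g' : L2 Ω}
    (h : IsWeakDeriv Ω v u g) (h' : IsWeakDeriv Ω v u' g') :
    IsWeakDeriv Ω v (u + u' : L2 Ω) (g + g' : L2 Ω) := by
  intro φ hφ hs ht
  have hd : Continuous (fun x => fderiv ℝ φ x v) :=
    (hφ.continuous_fderiv (by simp)).clm_apply continuous_const
  have hds := hasCompactSupport_fderiv_apply hs v
  have e1 : ∫ x in Ω, (u + u' : L2 Ω) x * fderiv ℝ φ x v =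
      ∫ x in Ω, (u x * fderiv ℝ φ x v + u' x * fderiv ℝ φ x v) := by
    apply integral_congr_ae
    filter_upwards [Lp.coeFn_add u u'] with x hx
    rw [hx, Pi.add_apply, add_mul]
  have e2 : ∫ x in Ω, (g + g' : L2 Ω) x * φ x = ∫ x in Ω, (g x * φ x + g' x * φ x) := by
    apply integral_congr_ae
    filter_upwards [Lp.coeFn_add g g'] with x hx
    rw [hx, Pi.add_apply, add_mul]
  rw [e1, e2, integral_add (integrable_L2_mul u hd hds) (integrable_L2_mul u' hd hds),
    integral_add (integrable_L2_mul g hφ.continuous hs) (integrable_L2_mul g' hφ.continuous hs),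
    h φ hφ hs ht, h' φ hφ hs ht]
  ring

theorem IsWeakDeriv.smul {n : ℕ} {Ω : Set (Space n)} {v : Space n} {u g : L2 Ω} (c : ℝ)
    (h : IsWeakDeriv Ω v u g) : IsWeakDeriv Ω v (c • u : L2 Ω) (c • g : L2 Ω) := by
  intro φ hφ hs ht
  have e1 : ∫ x in Ω, (c • u : L2 Ω) x * fderiv ℝ φ x v =
      ∫ x in Ω, c * (u x * fderiv ℝ φ x v) := by
    apply integral_congr_ae
    filter_upwards [Lp.coeFn_smul c u] with x hx
    rw [hx, Pi.smul_apply, smul_eq_mul, mul_assoc]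
  have e2 : ∫ x in Ω, (c • g : L2 Ω) x * φ x = ∫ x in Ω, c * (g x * φ x) := by
    apply integral_congr_ae
    filter_upwards [Lp.coeFn_smul c g] with x hx
    rw [hx, Pi.smul_apply, smul_eq_mul, mul_assoc]
  rw [e1, e2, integral_const_mul, integral_const_mul, h φ hφ hs ht]
  ring

theorem IsWeakDeriv.zero {n : ℕ} {Ω : Set (Space n)} {v : Space n} :
    IsWeakDeriv Ω v (0 : L2 Ω) (0 : L2 Ω) := by
  intro φ _ _ _
  have e (ψ : Space n → ℝ) : ∫ x in Ω, (0 : L2 Ω) x * ψ x = 0 := by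
    rw [← integral_zero (Space n) ℝ (μ := volume.restrict Ω)]
    apply integral_congr_ae
    filter_upwards [Lp.coeFn_zero ℝ 2 (volume.restrict Ω)] with x hx
    rw [hx, Pi.zero_apply, zero_mul]
  rw [e, e, neg_zero]

/-- The Sobolev space `H¹(Ω)`: the `u ∈ L²(Ω)` whose weak partial derivatives `∂_1 u, …, ∂_N u`
exist and lie in `L²(Ω)`. An element is stored as `(u, (∂_1 u, …, ∂_N u))`, where the second
component is determined by the first. The norm inherited from the `ℓ²` product is
`‖u‖₁ = (‖u‖₀² + ∑_l ‖∂_l u‖₀²)^{1/2}`. -/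
def H1 {n : ℕ} (Ω : Set (Space n)) :
    Submodule ℝ (WithLp 2 (L2 Ω × PiLp 2 (fun _ : Fin (n + 1) => L2 Ω))) where
  carrier := {p | ∀ l, IsWeakDeriv Ω (basisVec l) p.fst (p.snd l)}
  add_mem' hp hq l := (hp l).add (hq l)
  zero_mem' _ := IsWeakDeriv.zero
  smul_mem' c _ hp l := (hp l).smul c

/-- The function `u` underlying an element of `H¹(Ω)`, as an element of `L²(Ω)`. -/
def H1.fn {n : ℕ} {Ω : Set (Space n)} (r : H1 Ω) : L2 Ω := r.1.fst

/-! ### The geometry -/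

/-- The cylinder `Ω = Γ × (-1, 1)`. -/
def cyl {n : ℕ} (Γ : Set (EuclideanSpace ℝ (Fin n))) : Set (Space n) := Γ ×ˢ Ioo (-1 : ℝ) 1

/-- The unperturbed regions (`i = 1, 2`): `Ω_1 = Γ × (-1, 0)` and `Ω_2 = Γ × (0, 1)`. -/
def flatDomain {n : ℕ} (Γ : Set (EuclideanSpace ℝ (Fin n))) (i : ℕ) : Set (Space n) :=
  {x | x ∈ cyl Γ ∧ 0 < (-1) ^ i * x.2}

/-- The perturbed regions (`i = 1, 2`): `Ω_1^ζ = {X ∈ Ω : X_N < ζ(X̃)}` and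
`Ω_2^ζ = {X ∈ Ω : ζ(X̃) < X_N}`. -/
def pertDomain {n : ℕ} (Γ : Set (EuclideanSpace ℝ (Fin n))) (ζ : EuclideanSpace ℝ (Fin n) → ℝ)
    (i : ℕ) : Set (Space n) :=
  {X | X ∈ cyl Γ ∧ 0 < (-1) ^ i * (X.2 - ζ X.1)}

/-- `ζ` is piecewise `C¹` on the open set `Γ`: up to a null set, `Γ` is the union of finitely many
disjoint open pieces, on each of which `ζ` coincides with a `C¹` function on `Γ`
(so that `ζ` is `C¹` up to the interfaces between the pieces). -/
def PiecewiseC1 {n : ℕ} (Γ : Set (EuclideanSpace ℝ (Fin n)))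
    (ζ : EuclideanSpace ℝ (Fin n) → ℝ) : Prop :=
  ∃ (k : ℕ) (U : Fin k → Set (EuclideanSpace ℝ (Fin n)))
    (f : Fin k → EuclideanSpace ℝ (Fin n) → ℝ),
    (∀ j, IsOpen (U j) ∧ U j ⊆ Γ) ∧ Pairwise (fun j j' => Disjoint (U j) (U j')) ∧
    volume (Γ \ ⋃ j, U j) = 0 ∧
    ∀ j, ContDiffOn ℝ 1 (f j) Γ ∧ EqOn ζ (f j) (U j)

/-- The class of piecewise `C¹` perturbations of the interface `Γ` contained in `Ω`.
The last field says that the `W^{1,∞}(Γ)` norm of `ζ` is finite; for piecewise `C¹` functions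
the gradient exists almost everywhere. -/
structure IsPerturbation {n : ℕ} (Γ : Set (EuclideanSpace ℝ (Fin n)))
    (ζ : EuclideanSpace ℝ (Fin n) → ℝ) : Prop where
  continuousOn : ContinuousOn ζ (closure Γ)
  mem_cyl : ∀ x ∈ Γ, (x, ζ x) ∈ cyl Γ
  eq_zero : ∀ x ∈ frontier Γ, ζ x = 0
  piecewise : PiecewiseC1 Γ ζ
  gradient_lt_top : eLpNorm (∇ ζ) ⊤ (volume.restrict Γ) < ⊤

/-- `‖ζ‖_{L^∞(Γ)}`. -/
def supNorm {n : ℕ} (Γ : Set (EuclideanSpace ℝ (Fin n))) (ζ : EuclideanSpace ℝ (Fin n) → ℝ) : ℝ :=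
  (eLpNorm ζ ⊤ (volume.restrict Γ)).toReal

/-- `‖ζ‖_{W^{1,∞}(Γ)}`: the sum of the essential suprema of `|ζ|` and `|∇ζ|`. -/
def W1infNorm {n : ℕ} (Γ : Set (EuclideanSpace ℝ (Fin n)))
    (ζ : EuclideanSpace ℝ (Fin n) → ℝ) : ℝ :=
  supNorm Γ ζ + (eLpNorm (∇ ζ) ⊤ (volume.restrict Γ)).toReal

/-- `C_ζ = √ max {2, 4 ‖ζ‖²_{W^{1,∞}(Γ)}}`. -/
def Cζ {n : ℕ} (Γ : Set (EuclideanSpace ℝ (Fin n))) (ζ : EuclideanSpace ℝ (Fin n) → ℝ) : ℝ :=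
  √(max 2 (4 * W1infNorm Γ ζ ^ 2))

/-! ### The fractional mapping -/

/-- `Λ_i(X̃, X_N) = (X̃, (X_N - ζ(X̃)) / (1 - (-1)^i ζ(X̃)))`. -/
def Lam {n : ℕ} (ζ : EuclideanSpace ℝ (Fin n) → ℝ) (i : ℕ) (X : Space n) : Space n :=
  (X.1, (X.2 - ζ X.1) / (1 - (-1) ^ i * ζ X.1))

/-- The inverse of `Λ_i : Ω_i^ζ → Ω_i`, see `bijOn_Lam` and `invOn_LamInv`. -/
def LamInv {n : ℕ} (ζ : EuclideanSpace ℝ (Fin n) → ℝ) (i : ℕ) (x : Space n) : Space n :=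
  (x.1, x.2 * (1 - (-1) ^ i * ζ x.1) + ζ x.1)

/-- `T r = ∑_{i = 1, 2} (r ∘ Λ_i⁻¹) 1_{Ω_i}`. -/
def fracMap {n : ℕ} (Γ : Set (EuclideanSpace ℝ (Fin n))) (ζ : EuclideanSpace ℝ (Fin n) → ℝ)
    (r : Space n → ℝ) : Space n → ℝ :=
  fun x => ∑ i ∈ ({1, 2} : Finset ℕ), (flatDomain Γ i).indicator (r ∘ LamInv ζ i) x

section Inverse

variable {n : ℕ} {Γ : Set (EuclideanSpace ℝ (Fin n))} {ζ : EuclideanSpace ℝ (Fin n) → ℝ}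

theorem one_sub_pos (hζ : IsPerturbation Γ ζ) (i : ℕ) {x : EuclideanSpace ℝ (Fin n)} (hx : x ∈ Γ) :
    0 < 1 - (-1) ^ i * ζ x := by
  have h := (hζ.mem_cyl x hx).2
  simp only [mem_Ioo] at h
  rcases neg_one_pow_eq_or ℝ i with e | e <;> rw [e] <;> linarith [h.1, h.2]

theorem mapsTo_Lam (hζ : IsPerturbation Γ ζ) (i : ℕ) :
    MapsTo (Lam ζ i) (pertDomain Γ ζ i) (flatDomain Γ i) := by
  rintro X ⟨⟨h1, h2, h3⟩, h4⟩
  have hp := one_sub_pos hζ i h1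
  have hz := (hζ.mem_cyl X.1 h1).2
  simp only [mem_Ioo] at hz
  refine ⟨⟨h1, ?_, ?_⟩, ?_⟩
  · show -1 < (X.2 - ζ X.1) / (1 - (-1) ^ i * ζ X.1)
    rw [lt_div_iff₀ hp]
    rcases neg_one_pow_eq_or ℝ i with e | e <;> rw [e] at h4 ⊢ <;> linarith [hz.1, hz.2]
  · show (X.2 - ζ X.1) / (1 - (-1) ^ i * ζ X.1) < 1
    rw [div_lt_iff₀ hp]
    rcases neg_one_pow_eq_or ℝ i with e | e <;> rw [e] at h4 ⊢ <;> linarith [hz.1, hz.2]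
  · show 0 < (-1) ^ i * ((X.2 - ζ X.1) / (1 - (-1) ^ i * ζ X.1))
    rw [← mul_div_assoc]
    exact div_pos h4 hp

theorem mapsTo_LamInv (hζ : IsPerturbation Γ ζ) (i : ℕ) :
    MapsTo (LamInv ζ i) (flatDomain Γ i) (pertDomain Γ ζ i) := by
  rintro x ⟨⟨h1, h2, h3⟩, h4⟩
  have hp := one_sub_pos hζ i h1
  have hz := (hζ.mem_cyl x.1 h1).2
  simp only [mem_Ioo] at hz
  refine ⟨⟨h1, ?_, ?_⟩, ?_⟩
  · show -1 < x.2 * (1 - (-1) ^ i * ζ x.1) + ζ x.1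
    rcases neg_one_pow_eq_or ℝ i with e | e <;> rw [e] at h4 hp ⊢ <;> nlinarith [hz.1, hz.2]
  · show x.2 * (1 - (-1) ^ i * ζ x.1) + ζ x.1 < 1
    rcases neg_one_pow_eq_or ℝ i with e | e <;> rw [e] at h4 hp ⊢ <;> nlinarith [hz.1, hz.2]
  · show 0 < (-1) ^ i * (x.2 * (1 - (-1) ^ i * ζ x.1) + ζ x.1 - ζ x.1)
    rw [add_sub_cancel_right, ← mul_assoc]
    exact mul_pos h4 hp

/-- `LamInv ζ i` is the two-sided inverse of `Λ_i` between `Ω_i^ζ` and `Ω_i`. -/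
theorem invOn_LamInv (hζ : IsPerturbation Γ ζ) (i : ℕ) :
    InvOn (LamInv ζ i) (Lam ζ i) (pertDomain Γ ζ i) (flatDomain Γ i) := by
  constructor
  · intro X hX
    have hp := (one_sub_pos hζ i hX.1.1).ne'
    refine Prod.ext rfl ?_
    show (X.2 - ζ X.1) / (1 - (-1) ^ i * ζ X.1) * (1 - (-1) ^ i * ζ X.1) + ζ X.1 = X.2
    rw [div_mul_cancel₀ _ hp, sub_add_cancel]
  · intro x hx
    have hp := (one_sub_pos hζ i hx.1.1).ne'
    refine Prod.ext rfl ?_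
    show (x.2 * (1 - (-1) ^ i * ζ x.1) + ζ x.1 - ζ x.1) / (1 - (-1) ^ i * ζ x.1) = x.2
    rw [add_sub_cancel_right, mul_div_cancel_right₀ _ hp]

/-- `Λ_i` maps `Ω_i^ζ` bijectively onto `Ω_i`. -/
theorem bijOn_Lam (hζ : IsPerturbation Γ ζ) (i : ℕ) :
    BijOn (Lam ζ i) (pertDomain Γ ζ i) (flatDomain Γ i) :=
  (invOn_LamInv hζ i).bijOn (mapsTo_Lam hζ i) (mapsTo_LamInv hζ i)

end Inverse

end FractionalMapping

end

open FractionalMapping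

/-!
The two maps `Λ_1⁻¹`, `Λ_2⁻¹` glue to one map: since `(-1)^i z = |z|` on `Ω_i`, both are given by
`(x̃, z) ↦ (x̃, z + (1 - |z|) ζ(x̃))`. Extending `ζ` by zero and replacing `1 - |z|` by its positive
part, one obtains a homeomorphism `Φ` of the whole of `ℝ^N` (`unstraighten`) which is the identity
off `Ω`, and `T r = r ∘ Φ` up to a null set. As `Φ` is continuous across the interface, no jump
condition on `r` enters; what matters is that `Φ` is bi-Lipschitz and that composition with such a
map is an isomorphism of `H¹(Ω)` obeying the chain rule.

*Regularity of `ζ`.* The pieces of `ζ` are finitely many and the functions describing them are `C¹`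
across the interfaces, so near each point `ζ` is a continuous selection of finitely many `C¹`
functions whose gradients there are at most `‖∇ζ‖_∞`. A mean value inequality along segments makes
`ζ` Lipschitz with this constant; segments leaving `Γ` do no harm as `ζ` vanishes on `∂Γ`
(`abs_sub_le_of_eq_zero_of_notMem`, `lipschitzWith_zeroExt`). Compactness of the closure of `Γ`
gives `|ζ| ≤ s < 1`, whence the lower Lipschitz bound of `Φ`.

*Chain rule.* For smooth `v` and a test function `φ`, the composition `v ∘ Φ` is Lipschitz, and
Rademacher's theorem with integration by parts yields, after a change of variables, an identity
`∫ v w₀ = -∑ ∫ ∂_k v W_k`, where `w₀` and `W` are bounded with compact support in `Ω`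
(`integral_mul_fderiv_symm`). Such an identity persists when `v` is replaced by a function with
weak derivatives: mollify `w₀` and `W` rather than `v`, so that `W` becomes a test function, and
pass to the limit by dominated convergence (`integral_mul_eq_of_divergence`). Undoing the change of
variables gives the weak derivatives of `r ∘ Φ` (`isWeakDeriv_comp`). The inverse of `Φ` is of the
same kind, and uniqueness of weak derivatives (`H1.fn_injective`) gives linearity and invertibility.

*The bound.* The Jacobian determinant of `Φ` on `Ω` is `d = 1 ∓ ζ`, with `1 - s ≤ d ≤ 1 + s`,
`s = ‖ζ‖_∞`. The energy density of `r ∘ Φ` is at most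
`r² + 2 ∑_{l < N} (∂_l r)² + (2 ‖∇ζ‖_∞² + d²) (∂_N r)²` evaluated at `Φ`, and it is to be bounded by
`C_ζ² / (1 - s)` times `d` times the density of `r`, the factor `d` being absorbed by the change of
variables. This follows from `d ≥ 1 - s`, `d² ≤ (1 - s²) d / (1 - s)` and
`2 ‖∇ζ‖_∞² + 1 - s² ≤ C_ζ²` (`sum_sq_jacEntry_unstraighten_le`).
-/

namespace FractionalMapping

open Filter Topology
open scoped Convolution NNReal ENNReal

/-! ### Testing distributional divergence identities by mollification -/

theorem locallyIntegrable_of_abs_le {E : Type*} [TopologicalSpace E] [MeasurableSpace E]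
    {μ : Measure E} [IsLocallyFiniteMeasure μ] {w : E → ℝ} {C : ℝ} (hm : Measurable w)
    (hC : ∀ x, |w x| ≤ C) : LocallyIntegrable w μ := by
  refine (locallyIntegrable_const C).mono hm.aestronglyMeasurable (.of_forall fun x => ?_)
  rw [Real.norm_eq_abs, Real.norm_eq_abs]
  exact (hC x).trans (le_abs_self C)

section Mollification

variable {E : Type*} [NormedAddCommGroup E] [NormedSpace ℝ E] [FiniteDimensional ℝ E]
  [MeasurableSpace E] [BorelSpace E] {μ : Measure E} [μ.IsAddHaarMeasure]

theorem fderiv_convolution_apply_eq_neg_integral {ρ w : E → ℝ} (hρ : ContDiff ℝ 1 ρ)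
    (hc : HasCompactSupport ρ) (hw : LocallyIntegrable w μ) (x v : E) :
    fderiv ℝ (ρ ⋆[ContinuousLinearMap.lsmul ℝ ℝ, μ] w) x v =
      -∫ y, fderiv ℝ (fun y => ρ (x - y)) y v * w y ∂μ := by
  rw [(hc.hasFDerivAt_convolution_left _ hρ hw x).fderiv, convolution_def,
    ContinuousLinearMap.integral_apply, ← integral_sub_left_eq_self _ μ x, ← integral_neg]
  · congr 1 with y
    have hd : HasFDerivAt (fun y => ρ (x - y)) _ y :=
      (hρ.differentiable one_ne_zero (x - y)).hasFDerivAt.comp y ((hasFDerivAt_id y).const_sub x)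
    rw [sub_sub_cancel, hd.fderiv]
    simp [ContinuousLinearMap.precompL_apply]
  · exact (hc.fderiv (𝕜 := ℝ)).convolutionExists_left _ (hρ.continuous_fderiv one_ne_zero) hw x

theorem abs_normed_convolution_le (ρ : ContDiffBump (0 : E)) {w : E → ℝ} {C : ℝ}
    (hw : ∀ x, |w x| ≤ C) (x : E) :
    |(ρ.normed μ ⋆[ContinuousLinearMap.lsmul ℝ ℝ, μ] w) x| ≤ C := by
  have hint : Integrable (ρ.normed μ) μ :=
    ρ.continuous_normed.integrable_of_hasCompactSupport ρ.hasCompactSupport_normed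
  rw [convolution_def]
  calc |∫ t : E, ρ.normed μ t * w (x - t) ∂μ|
      ≤ ∫ t : E, ρ.normed μ t * C ∂μ := by
        rw [← Real.norm_eq_abs]
        refine norm_integral_le_of_norm_le (hint.mul_const C) (.of_forall fun t => ?_)
        rw [Real.norm_eq_abs, abs_mul, abs_of_nonneg (ρ.nonneg_normed t)]
        exact mul_le_mul_of_nonneg_left (hw _) (ρ.nonneg_normed t)
    _ = C := by rw [integral_mul_const, ρ.integral_normed, one_mul]

theorem normed_convolution_eq_zero_of_notMem_cthickening (ρ : ContDiffBump (0 : E)) {w : E → ℝ}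
    {K : Set E} {δ : ℝ} (hw : ∀ x ∉ K, w x = 0) (hδ : ρ.rOut ≤ δ) {x : E}
    (hx : x ∉ Metric.cthickening δ K) :
    (ρ.normed μ ⋆[ContinuousLinearMap.lsmul ℝ ℝ, μ] w) x = 0 := by
  rw [convolution_def]
  refine integral_eq_zero_of_ae (.of_forall fun t => ?_)
  by_cases ht : t ∈ Metric.ball (0 : E) ρ.rOut
  · have : x - t ∉ K := fun h => hx <| Metric.mem_cthickening_of_dist_le x (x - t) δ K h <| by
      rw [dist_eq_norm, sub_sub_cancel]
      exact (mem_ball_zero_iff.1 ht).le.trans hδ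
    simp [hw _ this]
  · rw [← ρ.support_normed_eq (μ := μ), Function.notMem_support] at ht
    simp [ht]

/-- Bounded measurable functions vanishing off a compact set `K` inside an open set `Ω` are limits
of their mollifications: the mollifiers can be chosen once and for all, the mollified functions
vanish off a fixed compact subset of `Ω`, and dominated convergence applies against any function
that is integrable on compact sets. -/
theorem exists_mollifiers {Ω K : Set E} (hΩ : IsOpen Ω) (hK : IsCompact K) (hKΩ : K ⊆ Ω) :
    ∃ (K' : Set E) (ρ : ℕ → ContDiffBump (0 : E)), IsCompact K' ∧ K' ⊆ Ω ∧
      ∀ (w : E → ℝ) (C : ℝ), Measurable w → (∀ x, |w x| ≤ C) → (∀ x ∉ K, w x = 0) →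
        (∀ i, ∀ x ∉ K', ((ρ i).normed μ ⋆[ContinuousLinearMap.lsmul ℝ ℝ, μ] w) x = 0) ∧
        ∀ u : E → ℝ, IntegrableOn u K' (μ.restrict Ω) →
          Tendsto (fun i => ∫ x in Ω, u x *
            ((ρ i).normed μ ⋆[ContinuousLinearMap.lsmul ℝ ℝ, μ] w) x ∂μ) atTop
            (𝓝 (∫ x in Ω, u x * w x ∂μ)) := by
  obtain ⟨δ, hδ, hδΩ⟩ := hK.exists_cthickening_subset_open hΩ hKΩ
  let ρ : ℕ → ContDiffBump (0 : E) := fun i =>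
    { rIn := δ / (i + 1) / 2
      rOut := δ / (i + 1)
      rIn_pos := by positivity
      rIn_lt_rOut := half_lt_self (by positivity) }
  have hρ : Tendsto (fun i => (ρ i).rOut) atTop (𝓝 0) := by
    have := (tendsto_one_div_add_atTop_nhds_zero_nat (𝕜 := ℝ)).const_mul δ
    simpa [ρ, div_eq_mul_inv] using this
  have hle (i : ℕ) : (ρ i).rOut ≤ δ := by
    refine div_le_self hδ.le ?_
    have : (0 : ℝ) ≤ i := Nat.cast_nonneg i
    linarith
  have hK' : IsCompact (Metric.cthickening δ K) := hK.cthickening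
  refine ⟨Metric.cthickening δ K, ρ, hK', hδΩ, fun w C hm hC hw => ?_⟩
  have hzero (i : ℕ) (x : E) (hx : x ∉ Metric.cthickening δ K) :=
    normed_convolution_eq_zero_of_notMem_cthickening (μ := μ) (ρ i) hw (hle i) hx
  have hloc : LocallyIntegrable w μ := locallyIntegrable_of_abs_le hm hC
  refine ⟨hzero, fun u hu => ?_⟩
  have key : Tendsto (fun i => ∫ x in Metric.cthickening δ K, u x *
      ((ρ i).normed μ ⋆[ContinuousLinearMap.lsmul ℝ ℝ, μ] w) x ∂(μ.restrict Ω)) atTop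
      (𝓝 (∫ x in Metric.cthickening δ K, u x * w x ∂(μ.restrict Ω))) := by
    refine tendsto_integral_of_dominated_convergence (fun x => |u x| * C) (fun i => ?_)
      (hu.abs.mul_const C) (fun i => .of_forall fun x => ?_) ?_
    · exact hu.aestronglyMeasurable.mul
        ((ρ i).hasCompactSupport_normed.contDiff_convolution_left (n := 0) _
          (ρ i).contDiff_normed hloc).continuous.aestronglyMeasurable
    · rw [Real.norm_eq_abs, abs_mul]
      exact mul_le_mul_of_nonneg_left (abs_normed_convolution_le _ hC x) (abs_nonneg _)
    · have := ContDiffBump.ae_convolution_tendsto_right_of_locallyIntegrable (μ := μ) (K := 2) hρ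
        (.of_forall fun i => by simp only [ρ]; linarith) hloc
      filter_upwards [ae_restrict_of_ae (ae_restrict_of_ae this)] with x hx
      exact hx.const_mul (u x)
  have hsub : K ⊆ Metric.cthickening δ K := Metric.self_subset_cthickening K
  convert key using 2
  · refine (setIntegral_eq_integral_of_forall_compl_eq_zero fun x hx => ?_).symm
    rw [hzero _ x hx, mul_zero]
  · refine (setIntegral_eq_integral_of_forall_compl_eq_zero fun x hx => ?_).symm
    rw [hw x fun h => hx (hsub h), mul_zero]

end Mollification

instance isAddHaarMeasure_volume_space {n : ℕ} :
    (volume : Measure (Space n)).IsAddHaarMeasure :=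
  inferInstanceAs ((volume : Measure (EuclideanSpace ℝ (Fin n))).prod
    (volume : Measure ℝ)).IsAddHaarMeasure

/-- An identity `w₀ = div W` between bounded measurable functions vanishing off a compact subset of
`Ω`, which holds in the sense of distributions, may be tested against a function with weak
derivatives on `Ω`: mollifying `w₀` and `W` gives admissible test functions. -/
theorem integral_mul_eq_of_divergence {n : ℕ} {Ω K : Set (Space n)} (hΩ : IsOpen Ω)
    (hK : IsCompact K) (hKΩ : K ⊆ Ω) {u : Space n → ℝ} {g : Fin (n + 1) → Space n → ℝ}
    (hu : ∀ K' ⊆ Ω, IsCompact K' → IntegrableOn u K' (volume.restrict Ω))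
    (hg : ∀ k, ∀ K' ⊆ Ω, IsCompact K' → IntegrableOn (g k) K' (volume.restrict Ω))
    (hug : ∀ k, IsWeakDeriv Ω (basisVec k) u (g k))
    {w₀ : Space n → ℝ} {W : Fin (n + 1) → Space n → ℝ} {C : ℝ}
    (hw₀ : Measurable w₀) (hw₀C : ∀ x, |w₀ x| ≤ C) (hw₀K : ∀ x ∉ K, w₀ x = 0)
    (hW : ∀ k, Measurable (W k)) (hWC : ∀ k x, |W k x| ≤ C) (hWK : ∀ k, ∀ x ∉ K, W k x = 0)
    (hdiv : ∀ v : Space n → ℝ, ContDiff ℝ ∞ v → HasCompactSupport v →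
      ∫ y, v y * w₀ y = -∑ k, ∫ y, fderiv ℝ v y (basisVec k) * W k y) :
    ∫ x in Ω, u x * w₀ x = -∑ k, ∫ x in Ω, g k x * W k x := by
  obtain ⟨K', ρ, hK', hK'Ω, hmoll⟩ := exists_mollifiers (μ := volume) hΩ hK hKΩ
  set c : ℕ → (Space n → ℝ) → Space n → ℝ := fun i w =>
    (ρ i).normed volume ⋆[ContinuousLinearMap.lsmul ℝ ℝ, volume] w with hc
  have hcs (i : ℕ) (k : Fin (n + 1)) : tsupport (c i (W k)) ⊆ K' :=
    closure_minimal (fun x hx => by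
      by_contra h
      exact hx ((hmoll (W k) C (hW k) (hWC k) (hWK k)).1 i x h)) hK'.isClosed
  have hcd (i : ℕ) (k : Fin (n + 1)) : ContDiff ℝ ∞ (c i (W k)) :=
    (ρ i).hasCompactSupport_normed.contDiff_convolution_left (n := ⊤) _
      (ρ i).contDiff_normed (locallyIntegrable_of_abs_le (hW k) (hWC k))
  have hcc (i : ℕ) (k : Fin (n + 1)) : HasCompactSupport (c i (W k)) :=
    hK'.of_isClosed_subset (isClosed_tsupport _) (hcs i k)
  -- The mollified identity is the given one with `v = ρ i (x - ·)`.
  have hdivc (i : ℕ) (x : Space n) : c i w₀ x = ∑ k, fderiv ℝ (c i (W k)) x (basisVec k) := by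
    have hv : ContDiff ℝ ∞ (fun y => (ρ i).normed volume (x - y)) :=
      (ρ i).contDiff_normed.comp (contDiff_const.sub contDiff_id)
    have hvc : HasCompactSupport (fun y => (ρ i).normed volume (x - y)) :=
      (ρ i).hasCompactSupport_normed.comp_homeomorph (Homeomorph.subLeft x)
    have h1 : c i w₀ x = ∫ y, (ρ i).normed volume (x - y) * w₀ y := by
      rw [hc]
      simp only
      rw [convolution_eq_swap]
      rfl
    rw [h1, hdiv _ hv hvc, ← Finset.sum_neg_distrib]
    refine Finset.sum_congr rfl fun k _ => ?_
    exact (fderiv_convolution_apply_eq_neg_integral (ρ i).contDiff_normed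
      (ρ i).hasCompactSupport_normed (locallyIntegrable_of_abs_le (hW k) (hWC k)) x _).symm
  -- The mollified fields are test functions for the weak derivatives of `u`.
  have hid (i : ℕ) : ∫ x in Ω, u x * c i w₀ x = -∑ k, ∫ x in Ω, g k x * c i (W k) x := by
    simp_rw [hdivc i, Finset.mul_sum]
    rw [integral_finsetSum, ← Finset.sum_neg_distrib]
    · exact Finset.sum_congr rfl fun k _ =>
        hug k _ (hcd i k) (hcc i k) ((hcs i k).trans hK'Ω)
    · intro k _
      have hcont : Continuous fun x => fderiv ℝ (c i (W k)) x (basisVec k) :=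
        ((hcd i k).continuous_fderiv (by simp)).clm_apply continuous_const
      refine (integrableOn_iff_integrable_of_support_subset fun x hx => ?_).1
        ((hu K' hK'Ω hK').mul_continuousOn hcont.continuousOn hK')
      refine hcs i k (tsupport_fderiv_subset ℝ ?_ )
      refine subset_tsupport _ fun h => hx ?_
      simp [h]
  refine tendsto_nhds_unique ((hmoll w₀ C hw₀ hw₀C hw₀K).2 u (hu K' hK'Ω hK')) ?_
  refine Tendsto.congr (fun i => (hid i).symm) ?_
  exact (tendsto_finsetSum _ fun k _ =>
    (hmoll (W k) C (hW k) (hWC k) (hWK k)).2 (g k) (hg k K' hK'Ω hK')).neg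

/-! ### Bi-Lipschitz changes of variables and the chain rule -/

/-- The coordinate functionals `x ↦ x_k` dual to `basisVec`. -/
noncomputable def coord {n : ℕ} (k : Fin (n + 1)) : Space n →L[ℝ] ℝ :=
  Fin.lastCases (ContinuousLinearMap.snd ℝ _ ℝ)
    (fun i => (EuclideanSpace.proj i).comp (ContinuousLinearMap.fst ℝ _ ℝ)) k

@[simp]
theorem coord_last {n : ℕ} (x : Space n) : coord (Fin.last n) x = x.2 := by
  simp [coord]

@[simp]
theorem coord_castSucc {n : ℕ} (i : Fin n) (x : Space n) : coord i.castSucc x = x.1 i := by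
  simp [coord]

@[simp]
theorem basisVec_last {n : ℕ} : basisVec (Fin.last n) = (0, 1) := by
  simp [basisVec]

@[simp]
theorem basisVec_castSucc {n : ℕ} (i : Fin n) :
    basisVec i.castSucc = (EuclideanSpace.single i 1, 0) := by
  simp [basisVec]

theorem sum_coord_smul_basisVec {n : ℕ} (x : Space n) : ∑ k, coord k x • basisVec k = x := by
  rw [Fin.sum_univ_castSucc]
  simp only [coord_castSucc, coord_last, basisVec_castSucc, basisVec_last]
  refine Prod.ext ?_ ?_
  · ext i
    simp [Prod.fst_sum, Pi.single_apply]
  · simp [Prod.snd_sum]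

theorem abs_coord_le {n : ℕ} (k : Fin (n + 1)) (x : Space n) : |coord k x| ≤ ‖x‖ := by
  refine Fin.lastCases ?_ (fun i => ?_) k
  · rw [coord_last]
    exact norm_snd_le x
  · rw [coord_castSucc]
    exact (PiLp.norm_apply_le x.1 i).trans (norm_fst_le x)

theorem norm_basisVec_le {n : ℕ} (k : Fin (n + 1)) : ‖basisVec k‖ ≤ 1 := by
  refine Fin.lastCases ?_ (fun i => ?_) k <;> simp [Prod.norm_def]

/-- The `(k, l)` entry `∂_l Φ_k(x)` of the Jacobian matrix of `Φ` (zero where `Φ` is not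
differentiable). -/
noncomputable def jacEntry {n : ℕ} (Φ : Space n → Space n) (k l : Fin (n + 1)) (x : Space n) : ℝ :=
  coord k (fderiv ℝ Φ x (basisVec l))

theorem measurable_jacEntry {n : ℕ} (Φ : Space n → Space n) (k l : Fin (n + 1)) :
    Measurable (jacEntry Φ k l) :=
  (coord k).continuous.measurable.comp (measurable_fderiv_apply_const ℝ Φ (basisVec l))

theorem abs_jacEntry_le {n : ℕ} {Φ : Space n → Space n} {C : ℝ≥0} (hΦ : LipschitzWith C Φ)
    (k l : Fin (n + 1)) (x : Space n) : |jacEntry Φ k l x| ≤ C :=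
  calc |jacEntry Φ k l x| ≤ ‖fderiv ℝ Φ x (basisVec l)‖ := abs_coord_le _ _
    _ ≤ ‖fderiv ℝ Φ x‖ * ‖basisVec l‖ := ContinuousLinearMap.le_opNorm _ _
    _ ≤ C * 1 := mul_le_mul (norm_fderiv_le_of_lipschitz ℝ hΦ) (norm_basisVec_le l)
        (norm_nonneg _) C.2
    _ = C := mul_one _

/-- A bi-Lipschitz change of variables `Φ` of the whole space preserving `Ω`, with Jacobian
determinant `j` bounded away from `0` and `∞`. The role of `j` is fixed by the change of variables
formula rather than by the derivative of `Φ`. -/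
structure IsBilipschitzChange {n : ℕ} (Ω : Set (Space n)) (Φ : Space n ≃ₜ Space n)
    (j : Space n → ℝ) : Prop where
  lipschitz : ∃ C, LipschitzWith C Φ
  lipschitz_symm : ∃ C, LipschitzWith C Φ.symm
  mem_iff : ∀ x, Φ x ∈ Ω ↔ x ∈ Ω
  measurable : Measurable j
  lower : ∃ a > 0, ∀ x, a ≤ j x
  upper : ∃ b, ∀ x, j x ≤ b
  lintegral_eq : ∀ G : Space n → ℝ≥0∞, Measurable G →
    ∫⁻ x, G (Φ x) * ENNReal.ofReal (j x) = ∫⁻ y, G y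

namespace IsBilipschitzChange

variable {n : ℕ} {Ω : Set (Space n)} {Φ : Space n ≃ₜ Space n} {j : Space n → ℝ}

theorem pos (h : IsBilipschitzChange Ω Φ j) (x : Space n) : 0 < j x := by
  obtain ⟨a, ha, hj⟩ := h.lower
  exact ha.trans_le (hj x)

theorem symm (h : IsBilipschitzChange Ω Φ j) :
    IsBilipschitzChange Ω Φ.symm fun y => (j (Φ.symm y))⁻¹ where
  lipschitz := h.lipschitz_symm
  lipschitz_symm := by simpa using h.lipschitz
  mem_iff x := by rw [← h.mem_iff, Φ.apply_symm_apply]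
  measurable := (h.measurable.comp Φ.symm.continuous.measurable).inv
  lower := by
    obtain ⟨b, hb⟩ := h.upper
    exact ⟨b⁻¹, inv_pos.2 ((h.pos 0).trans_le (hb 0)), fun x => inv_anti₀ (h.pos _) (hb _)⟩
  upper := by
    obtain ⟨a, ha, hj⟩ := h.lower
    exact ⟨a⁻¹, fun x => inv_anti₀ ha (hj _)⟩
  lintegral_eq G hG := by
    have hm : Measurable fun y => G (Φ.symm y) * ENNReal.ofReal (j (Φ.symm y))⁻¹ :=
      (hG.comp Φ.symm.continuous.measurable).mul
        (h.measurable.comp Φ.symm.continuous.measurable).inv.ennreal_ofReal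
    rw [← h.lintegral_eq _ hm]
    refine lintegral_congr fun x => ?_
    rw [Φ.symm_apply_apply, mul_assoc, ← ENNReal.ofReal_mul (inv_nonneg.2 (h.pos x).le),
      inv_mul_cancel₀ (h.pos x).ne', ENNReal.ofReal_one, mul_one]

theorem map_volume (h : IsBilipschitzChange Ω Φ j) :
    (volume : Measure (Space n)).map Φ =
      volume.withDensity fun y => ENNReal.ofReal (j (Φ.symm y))⁻¹ := by
  refine Measure.ext_of_lintegral _ fun G hG => ?_
  rw [lintegral_map hG Φ.continuous.measurable,
    lintegral_withDensity_eq_lintegral_mul _ h.symm.measurable.ennreal_ofReal hG,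
    ← h.symm.lintegral_eq (fun x => G (Φ x)) (hG.comp Φ.continuous.measurable)]
  refine lintegral_congr fun y => ?_
  simp [mul_comm]

theorem integral_comp (h : IsBilipschitzChange Ω Φ j) (F : Space n → ℝ) :
    ∫ x, F (Φ x) = ∫ y, F y * (j (Φ.symm y))⁻¹ := by
  rw [← Φ.measurableEmbedding.integral_map, h.map_volume,
    integral_withDensity_eq_integral_toReal_smul h.symm.measurable.ennreal_ofReal
      (.of_forall fun _ => ENNReal.ofReal_lt_top)]
  refine integral_congr_ae (.of_forall fun y => ?_)
  simp only [smul_eq_mul]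
  rw [ENNReal.toReal_ofReal (h.symm.pos y).le, mul_comm]

theorem setIntegral_comp (h : IsBilipschitzChange Ω Φ j) (hΩ : IsOpen Ω) (F : Space n → ℝ) :
    ∫ x in Ω, F (Φ x) = ∫ y in Ω, F y * (j (Φ.symm y))⁻¹ := by
  rw [← integral_indicator hΩ.measurableSet, ← integral_indicator hΩ.measurableSet]
  have : Ω.indicator (fun x => F (Φ x)) = fun x => Ω.indicator F (Φ x) := by
    ext x
    by_cases hx : x ∈ Ω
    · rw [indicator_of_mem hx, indicator_of_mem ((h.mem_iff x).2 hx)]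
    · rw [indicator_of_notMem hx, indicator_of_notMem fun h' => hx ((h.mem_iff x).1 h')]
  rw [this, h.integral_comp]
  refine integral_congr_ae (.of_forall fun y => ?_)
  by_cases hy : y ∈ Ω <;> simp [hy]

theorem exists_map_restrict_le (h : IsBilipschitzChange Ω Φ j) (hΩ : IsOpen Ω) :
    ∃ C : ℝ≥0∞, C ≠ ⊤ ∧
      ((volume : Measure (Space n)).restrict Ω).map Φ ≤ C • (volume.restrict Ω) := by
  obtain ⟨b, hb⟩ := h.symm.upper
  refine ⟨ENNReal.ofReal b, ENNReal.ofReal_ne_top, ?_⟩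
  have hpre : Φ ⁻¹' Ω = Ω := ext h.mem_iff
  have : ((volume : Measure (Space n)).restrict Ω).map Φ = (volume.map Φ).restrict Ω := by
    rw [Measure.restrict_map Φ.continuous.measurable hΩ.measurableSet, hpre]
  rw [this, h.map_volume, ← Measure.restrict_smul, ← withDensity_const]
  exact Measure.restrict_mono' (.of_forall fun _ => id)
    (withDensity_mono (.of_forall fun y => ENNReal.ofReal_le_ofReal (hb y)))

theorem quasiMeasurePreserving (h : IsBilipschitzChange Ω Φ j) (hΩ : IsOpen Ω) :
    Measure.QuasiMeasurePreserving Φ (volume.restrict Ω) (volume.restrict Ω) := by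
  obtain ⟨C, -, hC⟩ := h.exists_map_restrict_le hΩ
  exact ⟨Φ.continuous.measurable, (Measure.absolutelyContinuous_of_le hC).trans
    Measure.smul_absolutelyContinuous⟩

theorem memLp_comp (h : IsBilipschitzChange Ω Φ j) (hΩ : IsOpen Ω) {u : Space n → ℝ}
    (hu : MemLp u 2 (volume.restrict Ω)) : MemLp (fun x => u (Φ x)) 2 (volume.restrict Ω) := by
  obtain ⟨C, hC, hle⟩ := h.exists_map_restrict_le hΩ
  exact Φ.measurableEmbedding.memLp_map_measure_iff.1 (hu.of_measure_le_smul hC hle)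

/-- Integration by parts for the composition of a smooth function with `Φ`, pulled back to the
target variables: the distributional identity to which `integral_mul_eq_of_divergence` applies. -/
theorem integral_mul_fderiv_symm (h : IsBilipschitzChange Ω Φ j) {φ v : Space n → ℝ}
    (hφ : ContDiff ℝ ∞ φ) (hφc : HasCompactSupport φ) (hv : ContDiff ℝ ∞ v)
    (hvc : HasCompactSupport v) (l : Fin (n + 1)) :
    ∫ y, v y * (fderiv ℝ φ (Φ.symm y) (basisVec l) * (j (Φ.symm y))⁻¹) =
      -∑ k, ∫ y, fderiv ℝ v y (basisVec k) *
        (φ (Φ.symm y) * jacEntry Φ k l (Φ.symm y) * (j (Φ.symm y))⁻¹) := by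
  obtain ⟨C, hC⟩ := h.lipschitz
  obtain ⟨Cv, hCv⟩ := hv.lipschitzWith_of_hasCompactSupport hvc (by simp)
  obtain ⟨Cφ, hCφ⟩ := hφ.lipschitzWith_of_hasCompactSupport hφc (by simp)
  have hleft : ∫ y, v y * (fderiv ℝ φ (Φ.symm y) (basisVec l) * (j (Φ.symm y))⁻¹) =
      ∫ x, v (Φ x) * fderiv ℝ φ x (basisVec l) := by
    have := h.integral_comp fun y => v y * fderiv ℝ φ (Φ.symm y) (basisVec l)
    simp only [Φ.symm_apply_apply] at this
    rw [this]
    simp only [mul_assoc]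
  have hright (k : Fin (n + 1)) : ∫ y, fderiv ℝ v y (basisVec k) *
        (φ (Φ.symm y) * jacEntry Φ k l (Φ.symm y) * (j (Φ.symm y))⁻¹) =
      ∫ x, fderiv ℝ v (Φ x) (basisVec k) * φ x * jacEntry Φ k l x := by
    have := h.integral_comp fun y => fderiv ℝ v y (basisVec k) *
      φ (Φ.symm y) * jacEntry Φ k l (Φ.symm y)
    simp only [Φ.symm_apply_apply] at this
    rw [this]
    simp only [mul_assoc]
  rw [hleft, Finset.sum_congr rfl fun k _ => hright k, ← integral_finsetSum]
  · have hparts := LipschitzWith.integral_lineDeriv_mul_eq (μ := volume) (hCv.comp hC) hCφ hφc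
      (basisVec l)
    have hneg (x : Space n) : lineDeriv ℝ φ x (-basisVec l) = -fderiv ℝ φ x (basisVec l) := by
      rw [(hφ.differentiable (by simp) x).lineDeriv_eq_fderiv, map_neg]
    simp only [hneg, neg_mul, integral_neg] at hparts
    have hchain : ∀ᵐ x, lineDeriv ℝ (v ∘ Φ) x (basisVec l) * φ x =
        ∑ k, fderiv ℝ v (Φ x) (basisVec k) * φ x * jacEntry Φ k l x := by
      filter_upwards [hC.ae_differentiableAt (μ := volume)] with x hx
      have hd : HasFDerivAt (v ∘ Φ) ((fderiv ℝ v (Φ x)).comp (fderiv ℝ Φ x)) x :=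
        (hv.differentiable (by simp) (Φ x)).hasFDerivAt.comp x hx.hasFDerivAt
      rw [hd.differentiableAt.lineDeriv_eq_fderiv, hd.fderiv, ContinuousLinearMap.comp_apply,
        ← sum_coord_smul_basisVec (fderiv ℝ Φ x (basisVec l)), map_sum, Finset.sum_mul]
      refine Finset.sum_congr rfl fun k _ => ?_
      rw [map_smul, smul_eq_mul]
      unfold jacEntry
      ring
    rw [integral_congr_ae hchain] at hparts
    rw [hparts, neg_neg]
    exact integral_congr_ae (.of_forall fun x => mul_comm _ _)
  · intro k _
    have hcont : Continuous fun x => fderiv ℝ v (Φ x) (basisVec k) * φ x :=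
      (((hv.continuous_fderiv (by simp)).comp Φ.continuous).clm_apply continuous_const).mul
        hφ.continuous
    exact (hcont.integrable_of_hasCompactSupport hφc.mul_left).mul_bdd (c := (C : ℝ))
      (measurable_jacEntry Φ k l).aestronglyMeasurable
      (.of_forall fun x => abs_jacEntry_le hC k l x)

/-- The chain rule for weak derivatives under a bi-Lipschitz change of variables. -/
theorem isWeakDeriv_comp (h : IsBilipschitzChange Ω Φ j) (hΩ : IsOpen Ω) {u : Space n → ℝ}
    {g : Fin (n + 1) → Space n → ℝ} (hu : MemLp u 2 (volume.restrict Ω))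
    (hg : ∀ k, MemLp (g k) 2 (volume.restrict Ω))
    (hug : ∀ k, IsWeakDeriv Ω (basisVec k) u (g k)) (l : Fin (n + 1)) :
    IsWeakDeriv Ω (basisVec l) (fun x => u (Φ x))
      fun x => ∑ k, g k (Φ x) * jacEntry Φ k l x := by
  intro φ hφ hφc hφΩ
  obtain ⟨C, hC⟩ := h.lipschitz
  obtain ⟨b, hb⟩ := h.symm.upper
  have hb0 : 0 ≤ b := (h.symm.pos 0).le.trans (hb 0)
  have hcd : Continuous fun x => fderiv ℝ φ x (basisVec l) :=
    (hφ.continuous_fderiv (by simp)).clm_apply continuous_const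
  obtain ⟨A, hA⟩ := hφc.exists_bound_of_continuous hφ.continuous
  obtain ⟨A', hA'⟩ := (hasCompactSupport_fderiv_apply hφc (basisVec l)).exists_bound_of_continuous
    hcd
  have hA0 : 0 ≤ A := (norm_nonneg _).trans (hA 0)
  have hA'0 : 0 ≤ A' := (norm_nonneg _).trans (hA' 0)
  have hjb (y : Space n) : |(j (Φ.symm y))⁻¹| ≤ b := by
    rw [abs_of_pos (h.symm.pos y)]
    exact hb y
  have hK : IsCompact (Φ '' tsupport φ) := hφc.isCompact.image Φ.continuous
  have hKΩ : Φ '' tsupport φ ⊆ Ω := by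
    rintro _ ⟨x, hx, rfl⟩
    exact (h.mem_iff x).2 (hφΩ hx)
  have hout (y : Space n) (hy : y ∉ Φ '' tsupport φ) : Φ.symm y ∉ tsupport φ := fun h' =>
    hy ⟨_, h', Φ.apply_symm_apply y⟩
  have hint (w : Space n → ℝ) (hw : MemLp w 2 (volume.restrict Ω)) (K' : Set (Space n))
      (_ : K' ⊆ Ω) (hK' : IsCompact K') : IntegrableOn w K' (volume.restrict Ω) := by
    have : IsFiniteMeasure ((volume.restrict Ω).restrict K') :=
      isFiniteMeasure_restrict.2 (hK'.measure_lt_top).ne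
    exact (hw.restrict K').integrable one_le_two
  have key := integral_mul_eq_of_divergence hΩ hK hKΩ (hint u hu) (fun k => hint _ (hg k)) hug
    (w₀ := fun y => fderiv ℝ φ (Φ.symm y) (basisVec l) * (j (Φ.symm y))⁻¹)
    (W := fun k y => φ (Φ.symm y) * jacEntry Φ k l (Φ.symm y) * (j (Φ.symm y))⁻¹)
    (C := max (A' * b) (A * C * b))
    ((hcd.measurable.comp Φ.symm.continuous.measurable).mul h.symm.measurable)
    (fun y => by
      rw [abs_mul]
      exact (mul_le_mul (hA' _) (hjb y) (abs_nonneg _) hA'0).trans (le_max_left _ _))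
    (fun y hy => by
      have : fderiv ℝ φ (Φ.symm y) = 0 := by
        by_contra h'
        exact hout y hy (tsupport_fderiv_subset ℝ (subset_tsupport _ h'))
      simp [this])
    (fun k => ((hφ.continuous.measurable.comp Φ.symm.continuous.measurable).mul
      ((measurable_jacEntry Φ k l).comp Φ.symm.continuous.measurable)).mul h.symm.measurable)
    (fun k y => by
      rw [abs_mul, abs_mul]
      exact (mul_le_mul (mul_le_mul (hA _) (abs_jacEntry_le hC k l _) (abs_nonneg _) hA0)
        (hjb y) (abs_nonneg _) (mul_nonneg hA0 C.2)).trans (le_max_right _ _))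
    (fun k y hy => by simp [image_eq_zero_of_notMem_tsupport (hout y hy)])
    (fun v hv hvc => h.integral_mul_fderiv_symm hφ hφc hv hvc l)
  have hleft := h.setIntegral_comp hΩ fun y => u y * fderiv ℝ φ (Φ.symm y) (basisVec l)
  have hright (k : Fin (n + 1)) := h.setIntegral_comp hΩ fun y =>
    g k y * (φ (Φ.symm y) * jacEntry Φ k l (Φ.symm y))
  simp only [Φ.symm_apply_apply] at hleft hright
  simp only [← mul_assoc] at key hleft hright
  rw [hleft, key, ← Finset.sum_congr rfl fun k _ => hright k, ← integral_finsetSum]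
  · congr 1
    refine integral_congr_ae (.of_forall fun x => ?_)
    simp only [Finset.sum_mul]
    exact Finset.sum_congr rfl fun k _ => by ring
  · intro k _
    have hφ2 : MemLp φ 2 (volume.restrict Ω) :=
      (hφ.continuous.memLp_of_hasCompactSupport hφc).restrict Ω
    exact ((h.memLp_comp hΩ (hg k)).integrable_mul hφ2).mul_bdd (c := (C : ℝ))
      (measurable_jacEntry Φ k l).aestronglyMeasurable
      (.of_forall fun x => abs_jacEntry_le hC k l x)

end IsBilipschitzChange

/-! ### Composition operators on `H¹` -/

/-- The weak partial derivative `∂_l r` of an element of `H¹(Ω)`. -/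
noncomputable def H1.partialDeriv {n : ℕ} {Ω : Set (Space n)} (r : H1 Ω) (l : Fin (n + 1)) : L2 Ω :=
  r.1.snd l

theorem ofReal_norm_sq_eq_lintegral {n : ℕ} {Ω : Set (Space n)} (u : L2 Ω) :
    ENNReal.ofReal (‖u‖ ^ 2) = ∫⁻ x in Ω, ENNReal.ofReal (u x ^ 2) := by
  rw [← ofReal_integral_eq_lintegral_ofReal (Lp.memLp u).integrable_sq
    (.of_forall fun x => sq_nonneg _), ← real_inner_self_eq_norm_sq, L2.inner_def]
  congr 1
  exact integral_congr_ae (.of_forall fun x => by simp [sq])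

/-- The density `|r|² + ∑_l |∂_l r|²` of the squared `H¹` norm. -/
noncomputable def H1.density {n : ℕ} {Ω : Set (Space n)} (r : H1 Ω) (x : Space n) : ℝ :=
  H1.fn r x ^ 2 + ∑ l, H1.partialDeriv r l x ^ 2

theorem H1.measurable_density {n : ℕ} {Ω : Set (Space n)} (r : H1 Ω) :
    Measurable (H1.density r) :=
  ((Lp.stronglyMeasurable _).measurable.pow_const 2).add <|
    Finset.measurable_fun_sum _ fun _ _ => (Lp.stronglyMeasurable _).measurable.pow_const 2

theorem H1.ofReal_norm_sq {n : ℕ} {Ω : Set (Space n)} (r : H1 Ω) :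
    ENNReal.ofReal (‖r‖ ^ 2) = ∫⁻ x in Ω, ENNReal.ofReal (H1.density r x) := by
  have hnorm : ‖r‖ ^ 2 = ‖H1.fn r‖ ^ 2 + ∑ l, ‖H1.partialDeriv r l‖ ^ 2 := by
    change ‖r.1‖ ^ 2 = _
    rw [WithLp.prod_norm_sq_eq_of_L2, PiLp.norm_sq_eq_of_L2]
    rfl
  have hm (u : L2 Ω) : Measurable fun x => ENNReal.ofReal (u x ^ 2) :=
    ((Lp.stronglyMeasurable u).measurable.pow_const 2).ennreal_ofReal
  rw [hnorm, ENNReal.ofReal_add (sq_nonneg _) (Finset.sum_nonneg fun _ _ => sq_nonneg _),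
    ENNReal.ofReal_sum_of_nonneg fun _ _ => sq_nonneg _]
  simp only [ofReal_norm_sq_eq_lintegral]
  rw [← lintegral_finsetSum _ fun l _ => hm _, ← lintegral_add_left (hm _)]
  refine lintegral_congr fun x => ?_
  rw [H1.density, ENNReal.ofReal_add (sq_nonneg _) (Finset.sum_nonneg fun _ _ => sq_nonneg _),
    ENNReal.ofReal_sum_of_nonneg fun _ _ => sq_nonneg _]

theorem IsWeakDeriv.congr_ae {n : ℕ} {Ω : Set (Space n)} {v : Space n}
    {u g u' g' : Space n → ℝ} (h : IsWeakDeriv Ω v u g)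
    (hu : u' =ᵐ[volume.restrict Ω] u) (hg : g' =ᵐ[volume.restrict Ω] g) :
    IsWeakDeriv Ω v u' g' := by
  intro φ hφ hφc hφΩ
  refine (integral_congr_ae ?_).trans ((h φ hφ hφc hφΩ).trans (congrArg _ (integral_congr_ae ?_)))
  · filter_upwards [hu] with x hx
    rw [hx]
  · filter_upwards [hg] with x hx
    rw [hx]

/-- Weak derivatives are unique, so an element of `H¹(Ω)` is determined by its function. -/
theorem H1.fn_injective {n : ℕ} {Ω : Set (Space n)} (hΩ : IsOpen Ω) :
    Function.Injective (H1.fn : H1 Ω → L2 Ω) := by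
  have hzero (d : H1 Ω) (hd : H1.fn d = 0) (l : Fin (n + 1)) : d.1.snd l = 0 := by
    have hmem : MemLp (d.1.snd l) 2 (volume.restrict Ω) := Lp.memLp _
    have hloc : LocallyIntegrableOn (d.1.snd l) Ω volume :=
      locallyIntegrableOn_of_locallyIntegrable_restrict (hmem.locallyIntegrable (by norm_num))
    have := hΩ.ae_eq_zero_of_integral_contDiff_smul_eq_zero hloc fun φ hφ hφc hφΩ => by
      have h := d.2 l φ hφ hφc hφΩ
      have hl : ∫ x in Ω, d.1.fst x * fderiv ℝ φ x (basisVec l) = 0 := by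
        refine integral_eq_zero_of_ae ?_
        have : (d.1.fst : Space n → ℝ) =ᵐ[volume.restrict Ω] 0 := by
          have h0 : d.1.fst = 0 := hd
          rw [h0]
          exact Lp.coeFn_zero _ _ _
        filter_upwards [this] with x hx
        simp [hx]
      rw [hl, eq_comm, neg_eq_zero] at h
      rw [← h, setIntegral_eq_integral_of_forall_compl_eq_zero fun x hx => by
        rw [image_eq_zero_of_notMem_tsupport fun h' => hx (hφΩ h'), mul_zero]]
      exact integral_congr_ae (.of_forall fun x => mul_comm _ _)
    refine Lp.ext ?_
    filter_upwards [(ae_restrict_iff' hΩ.measurableSet).2 this,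
      Lp.coeFn_zero ℝ 2 (volume.restrict Ω)] with x hx hx0
    rw [hx, hx0, Pi.zero_apply]
  intro r q hrq
  rw [← sub_eq_zero]
  have hd : H1.fn (r - q) = 0 := sub_eq_zero.2 hrq
  refine Subtype.ext (WithLp.ofLp_injective 2 (Prod.ext hd (PiLp.ext fun l => ?_)))
  exact hzero _ hd l

namespace IsBilipschitzChange

variable {n : ℕ} {Ω : Set (Space n)} {Φ : Space n ≃ₜ Space n} {j : Space n → ℝ}

/-- `q` is the composition `r ∘ Φ`, with the derivatives given by the chain rule. -/
def IsComp (Φ : Space n → Space n) (r q : H1 Ω) : Prop :=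
  (H1.fn q =ᵐ[volume.restrict Ω] fun x => H1.fn r (Φ x)) ∧
  ∀ l, H1.partialDeriv q l =ᵐ[volume.restrict Ω]
    fun x => ∑ k, H1.partialDeriv r k (Φ x) * jacEntry Φ k l x

theorem exists_isComp (h : IsBilipschitzChange Ω Φ j) (hΩ : IsOpen Ω) (r : H1 Ω) :
    ∃ q : H1 Ω, IsComp Φ r q := by
  obtain ⟨C, hC⟩ := h.lipschitz
  have hu := h.memLp_comp hΩ (Lp.memLp (H1.fn r))
  have hg (l : Fin (n + 1)) : MemLp (fun x => ∑ k, H1.partialDeriv r k (Φ x) * jacEntry Φ k l x) 2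
      (volume.restrict Ω) := by
    refine memLp_finsetSum _ fun k _ => ?_
    refine (h.memLp_comp hΩ (Lp.memLp (H1.partialDeriv r k))).of_le_mul (c := C) ?_
      (.of_forall fun x => ?_)
    · exact (h.memLp_comp hΩ (Lp.memLp (H1.partialDeriv r k))).aestronglyMeasurable.mul
        (measurable_jacEntry Φ k l).aestronglyMeasurable
    · rw [norm_mul, mul_comm]
      exact mul_le_mul_of_nonneg_right (abs_jacEntry_le hC k l x) (norm_nonneg _)
  refine ⟨⟨WithLp.toLp 2 (hu.toLp, WithLp.toLp 2 fun l => (hg l).toLp), fun l => ?_⟩,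
    hu.coeFn_toLp, fun l => (hg l).coeFn_toLp⟩
  exact IsWeakDeriv.congr_ae (h.isWeakDeriv_comp hΩ (Lp.memLp (H1.fn r))
    (fun k => Lp.memLp (H1.partialDeriv r k)) (fun k => r.2 k) l) hu.coeFn_toLp (hg l).coeFn_toLp

theorem setLIntegral_eq (h : IsBilipschitzChange Ω Φ j) (hΩ : IsOpen Ω) {G : Space n → ℝ≥0∞}
    (hG : Measurable G) :
    ∫⁻ x in Ω, G (Φ x) * ENNReal.ofReal (j x) = ∫⁻ y in Ω, G y := by
  rw [← lintegral_indicator hΩ.measurableSet, ← lintegral_indicator hΩ.measurableSet,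
    ← h.lintegral_eq _ (hG.indicator hΩ.measurableSet)]
  refine lintegral_congr fun x => ?_
  by_cases hx : x ∈ Ω
  · rw [indicator_of_mem hx, indicator_of_mem ((h.mem_iff x).2 hx)]
  · rw [indicator_of_notMem hx, indicator_of_notMem fun h' => hx ((h.mem_iff x).1 h'), zero_mul]

/-- A pointwise bound of the transformed energy density by `B j` times the original one gives a
bound for the `H¹` norm: the factor `j` is absorbed by the change of variables. -/
theorem norm_sq_le_of_isComp (h : IsBilipschitzChange Ω Φ j) (hΩ : IsOpen Ω) {r q : H1 Ω}
    (hq : IsComp Φ r q) {B : ℝ} (hB0 : 0 ≤ B)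
    (hB : ∀ᵐ x ∂(volume.restrict Ω), 1 ≤ B * j x ∧ ∀ c : Fin (n + 1) → ℝ,
      ∑ l, (∑ k, c k * jacEntry Φ k l x) ^ 2 ≤ B * j x * ∑ k, c k ^ 2) :
    ‖q‖ ^ 2 ≤ B * ‖r‖ ^ 2 := by
  rw [← ENNReal.ofReal_le_ofReal_iff (by positivity), ENNReal.ofReal_mul hB0, H1.ofReal_norm_sq,
    H1.ofReal_norm_sq, ← h.setLIntegral_eq hΩ (H1.measurable_density r).ennreal_ofReal,
    ← lintegral_const_mul' _ _ ENNReal.ofReal_ne_top]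
  refine lintegral_mono_ae ?_
  filter_upwards [hB, hq.1, ae_all_iff.2 hq.2] with x hx h0 hl
  rw [← ENNReal.ofReal_mul' (h.pos x).le, ← ENNReal.ofReal_mul hB0]
  refine ENNReal.ofReal_le_ofReal ?_
  simp only [H1.density, h0, hl]
  have h1 := hx.2 fun k => H1.partialDeriv r k (Φ x)
  have h2 := mul_le_mul_of_nonneg_right hx.1 (sq_nonneg (H1.fn r (Φ x)))
  linarith

theorem exists_norm_sq_le (h : IsBilipschitzChange Ω Φ j) (hΩ : IsOpen Ω) :
    ∃ B : ℝ, 0 ≤ B ∧ ∀ r q : H1 Ω, IsComp Φ r q → ‖q‖ ^ 2 ≤ B * ‖r‖ ^ 2 := by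
  obtain ⟨C, hC⟩ := h.lipschitz
  obtain ⟨a, ha, hja⟩ := h.lower
  set A : ℝ := ∑ _l : Fin (n + 1), ∑ _k : Fin (n + 1), (C : ℝ) ^ 2
  have hA : 0 ≤ A := Finset.sum_nonneg fun _ _ => Finset.sum_nonneg fun _ _ => sq_nonneg _
  have hle (x : Space n) : A + 1 ≤ (A + 1) / a * j x := by
    rw [div_mul_eq_mul_div, le_div_iff₀ ha]
    exact mul_le_mul_of_nonneg_left (hja x) (by linarith)
  refine ⟨(A + 1) / a, by positivity, fun r q hq => h.norm_sq_le_of_isComp hΩ hq (by positivity)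
    (.of_forall fun x => ⟨by linarith [hle x], fun c => ?_⟩)⟩
  have hc : 0 ≤ ∑ k, c k ^ 2 := Finset.sum_nonneg fun _ _ => sq_nonneg _
  calc ∑ l, (∑ k, c k * jacEntry Φ k l x) ^ 2
      ≤ ∑ _l : Fin (n + 1), (∑ k, c k ^ 2) * ∑ _k : Fin (n + 1), (C : ℝ) ^ 2 := by
        refine Finset.sum_le_sum fun l _ => (Finset.sum_mul_sq_le_sq_mul_sq _ _ _).trans ?_
        refine mul_le_mul_of_nonneg_left (Finset.sum_le_sum fun k _ => ?_) hc
        exact sq_le_sq.2 ((abs_jacEntry_le hC k l x).trans (le_abs_self _))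
    _ = A * ∑ k, c k ^ 2 := by rw [← Finset.mul_sum, mul_comm]
    _ ≤ (A + 1) / a * j x * ∑ k, c k ^ 2 :=
        mul_le_mul_of_nonneg_right (by linarith [hle x]) hc

/-- Composition with a bi-Lipschitz change of variables preserving `Ω`, as a bounded operator. -/
theorem exists_continuousLinearMap (h : IsBilipschitzChange Ω Φ j) (hΩ : IsOpen Ω) :
    ∃ T : H1 Ω →L[ℝ] H1 Ω, ∀ r, IsComp Φ r (T r) := by
  choose T hT using h.exists_isComp hΩ
  obtain ⟨B, hB0, hB⟩ := h.exists_norm_sq_le hΩ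
  have hqm := h.quasiMeasurePreserving hΩ
  let L : H1 Ω →ₗ[ℝ] H1 Ω :=
    { toFun := T
      map_add' := fun r q => H1.fn_injective hΩ <| Lp.ext <| by
        filter_upwards [(hT (r + q)).1, (hT r).1, (hT q).1,
          Lp.coeFn_add (H1.fn (T r)) (H1.fn (T q)),
          hqm.ae (Lp.coeFn_add (H1.fn r) (H1.fn q))] with x h1 h2 h3 h4 h5
        rw [h1]
        refine h5.trans (Eq.trans ?_ h4.symm)
        rw [Pi.add_apply, Pi.add_apply, h2, h3]
      map_smul' := fun c r => H1.fn_injective hΩ <| Lp.ext <| by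
        filter_upwards [(hT (c • r)).1, (hT r).1, Lp.coeFn_smul c (H1.fn (T r)),
          hqm.ae (Lp.coeFn_smul c (H1.fn r))] with x h1 h2 h4 h5
        rw [h1]
        refine h5.trans (Eq.trans ?_ h4.symm)
        rw [Pi.smul_apply, Pi.smul_apply, h2] }
  refine ⟨L.mkContinuous (√B) fun r => ?_, hT⟩
  rw [← abs_of_nonneg (norm_nonneg (L r))]
  refine Real.abs_le_sqrt (hB r _ (hT r)) |>.trans ?_
  rw [Real.sqrt_mul hB0, Real.sqrt_sq (norm_nonneg r)]

/-- Composition with a bi-Lipschitz change of variables preserving `Ω` is an isomorphism of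
`H¹(Ω)`; its inverse is composition with the inverse map. -/
theorem exists_continuousLinearEquiv (h : IsBilipschitzChange Ω Φ j) (hΩ : IsOpen Ω) :
    ∃ T : H1 Ω ≃L[ℝ] H1 Ω, ∀ r, IsComp Φ r (T r) := by
  obtain ⟨T, hT⟩ := h.exists_continuousLinearMap hΩ
  obtain ⟨S, hS⟩ := h.symm.exists_continuousLinearMap hΩ
  refine ⟨ContinuousLinearEquiv.equivOfInverse T S (fun r => ?_) (fun r => ?_), hT⟩
  · refine H1.fn_injective hΩ (Lp.ext ?_)
    filter_upwards [(hS (T r)).1, (h.symm.quasiMeasurePreserving hΩ).ae (hT r).1] with x h1 h2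
    rw [h1, h2, Φ.apply_symm_apply]
  · refine H1.fn_injective hΩ (Lp.ext ?_)
    filter_upwards [(hT (S r)).1, (h.quasiMeasurePreserving hΩ).ae (hS r).1] with x h1 h2
    rw [h1, h2, Φ.symm_apply_apply]

end IsBilipschitzChange

/-! ### Lipschitz continuity of the perturbation -/

section Lipschitz

variable {E : Type*} [NormedAddCommGroup E] [NormedSpace ℝ E] {Γ : Set E} {f : E → ℝ} {M : ℝ}

/-- A continuous function whose pointwise Lipschitz constant is at most `M` along a segment, its
endpoint excepted, satisfies the `M`-Lipschitz estimate on that segment. -/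
theorem abs_sub_le_of_segment (hf : Continuous f)
    (hloc : ∀ x ∈ Γ, ∀ ε > 0, ∀ᶠ y in 𝓝 x, |f y - f x| ≤ (M + ε) * ‖y - x‖) {x y : E}
    (hxy : ∀ t ∈ Ico (0 : ℝ) 1, x + t • (y - x) ∈ Γ) : |f x - f y| ≤ M * ‖x - y‖ := by
  set L := ‖y - x‖ with hL
  have hL0 : 0 ≤ L := norm_nonneg _
  set γ : ℝ → E := fun t => x + t • (y - x) with hγ
  have hγc : Continuous γ := by fun_prop
  have hγd (s t : ℝ) (hst : t < s) : ‖γ s - γ t‖ = (s - t) * L := by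
    simp only [hγ, add_sub_add_left_eq_sub, ← sub_smul, norm_smul, Real.norm_eq_abs,
      abs_of_pos (sub_pos.2 hst), hL]
  have key (ε : ℝ) (hε : 0 < ε) : |f y - f x| ≤ M * L + ε := by
    have := image_norm_le_of_liminf_right_slope_norm_lt_deriv_boundary (a := 0) (b := 1)
      (f := fun t => f (γ t) - f x) (f' := fun _ => M * L) (B := fun t => (M * L + ε) * t)
      (B' := fun _ => M * L + ε) (by fun_prop) (fun t ht r hr => ?_) (by simp [hγ]) (by fun_prop)
      (fun t _ => by simpa using ((hasDerivAt_id t).const_mul (M * L + ε)).hasDerivWithinAt)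
      (fun _ _ _ => by linarith) (right_mem_Icc.2 zero_le_one)
    · simpa [hγ] using this
    · have hε' : 0 < (r - M * L) / (L + 1) := div_pos (sub_pos.2 hr) (by linarith)
      have hlt : (M + (r - M * L) / (L + 1)) * L < r := by
        have h1 : (r - M * L) / (L + 1) * (L + 1) = r - M * L :=
          div_mul_cancel₀ _ (by linarith)
        linarith
      refine Eventually.frequently ?_
      have hev := (hγc.tendsto t).eventually (hloc (γ t) (hxy t ht) _ hε')
      filter_upwards [nhdsWithin_le_nhds hev, self_mem_nhdsWithin] with s hs hts
      have hts : t < s := hts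
      rw [slope_def_field, div_lt_iff₀ (sub_pos.2 hts)]
      calc ‖f (γ s) - f x‖ - ‖f (γ t) - f x‖ ≤ ‖f (γ s) - f x - (f (γ t) - f x)‖ :=
            norm_sub_norm_le _ _
        _ = |f (γ s) - f (γ t)| := by rw [sub_sub_sub_cancel_right, Real.norm_eq_abs]
        _ ≤ (M + (r - M * L) / (L + 1)) * ((s - t) * L) := by rw [← hγd s t hts]; exact hs
        _ = (M + (r - M * L) / (L + 1)) * L * (s - t) := by ring
        _ < r * (s - t) := mul_lt_mul_of_pos_right hlt (sub_pos.2 hts)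
  rw [abs_sub_comm, norm_sub_rev]
  exact le_of_forall_pos_le_add key

/-- A continuous function that vanishes off the open set `Γ` and has pointwise Lipschitz constant
at most `M` in `Γ` is `M`-Lipschitz. No regularity of `Γ` is needed: a segment leaving `Γ` does so
at a zero of the function. -/
theorem abs_sub_le_of_eq_zero_of_notMem (hΓ : IsOpen Γ) (hM : 0 ≤ M) (hf : Continuous f)
    (hf0 : ∀ x ∉ Γ, f x = 0)
    (hloc : ∀ x ∈ Γ, ∀ ε > 0, ∀ᶠ y in 𝓝 x, |f y - f x| ≤ (M + ε) * ‖y - x‖) (x y : E) :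
    |f x - f y| ≤ M * ‖x - y‖ := by
  have hexit (x z : E) (hz : z ∉ Γ) : |f x| ≤ M * ‖x - z‖ := by
    by_cases hx : x ∈ Γ
    swap
    · rw [hf0 x hx, abs_zero]
      positivity
    set γ : ℝ → E := fun t => x + t • (z - x) with hγ
    have hγc : Continuous γ := by fun_prop
    set A : Set ℝ := Icc 0 1 ∩ γ ⁻¹' Γᶜ with hA
    -- `sInf A` is the first time at which the segment from `x` to `z` is outside `Γ`.
    have hAc : IsCompact A := isCompact_Icc.inter_right (hΓ.isClosed_compl.preimage hγc)
    have hAne : A.Nonempty := ⟨1, right_mem_Icc.2 zero_le_one, by simpa [hγ] using hz⟩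
    obtain ⟨⟨hτ0, hτ1⟩, hτΓ⟩ := hAc.sInf_mem hAne
    set τ := sInf A
    have h := abs_sub_le_of_segment hf hloc (x := x) (y := γ τ) fun t ht => by
      by_contra hn
      have hmem : t * τ ∈ A := ⟨⟨mul_nonneg ht.1 hτ0, mul_le_one₀ ht.2.le hτ0 hτ1⟩, by
        simpa [hγ, smul_smul] using hn⟩
      have hle : τ ≤ t * τ := csInf_le hAc.bddBelow hmem
      have hτpos : 0 < τ := hτ0.lt_of_ne fun h0 => hτΓ (by simpa [hγ, ← h0] using hx)
      nlinarith [ht.2]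
    rw [hf0 _ hτΓ, sub_zero] at h
    refine h.trans (mul_le_mul_of_nonneg_left ?_ hM)
    simp only [hγ, sub_add_cancel_left, norm_neg, norm_smul, Real.norm_eq_abs, abs_of_nonneg hτ0]
    rw [norm_sub_rev x z]
    exact mul_le_of_le_one_left (norm_nonneg _) hτ1
  by_cases h : ∃ t ∈ Icc (0 : ℝ) 1, x + t • (y - x) ∉ Γ
  · obtain ⟨t, ht, hz⟩ := h
    have hseg : x + t • (y - x) ∈ segment ℝ x y := by
      rw [segment_eq_image']
      exact ⟨t, ht, rfl⟩
    have hd := dist_add_dist_of_mem_segment hseg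
    rw [dist_eq_norm, dist_eq_norm, dist_eq_norm] at hd
    calc |f x - f y| ≤ |f x| + |f y| := abs_sub _ _
      _ ≤ M * ‖x - (x + t • (y - x))‖ + M * ‖y - (x + t • (y - x))‖ :=
        add_le_add (hexit _ _ hz) (hexit _ _ hz)
      _ = M * ‖x - y‖ := by rw [← hd, norm_sub_rev y, mul_add]
  · push Not at h
    exact abs_sub_le_of_segment hf hloc fun t ht => h t (Ico_subset_Icc_self ht)

end Lipschitz

section Perturbation

variable {n : ℕ} {Γ : Set (EuclideanSpace ℝ (Fin n))} {ζ : EuclideanSpace ℝ (Fin n) → ℝ}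

/-- `‖∇ζ‖_{L^∞(Γ)}`. -/
noncomputable def gradNorm (Γ : Set (EuclideanSpace ℝ (Fin n)))
    (ζ : EuclideanSpace ℝ (Fin n) → ℝ) : ℝ :=
  (eLpNorm (∇ ζ) ⊤ (volume.restrict Γ)).toReal

theorem ae_norm_fderiv_le_gradNorm (hζ : IsPerturbation Γ ζ) :
    ∀ᵐ x ∂(volume.restrict Γ), ‖fderiv ℝ ζ x‖ ≤ gradNorm Γ ζ := by
  have h := ae_le_eLpNormEssSup (f := ∇ ζ) (μ := volume.restrict Γ)
  filter_upwards [h] with x hx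
  have h1 := ENNReal.toReal_mono hζ.gradient_lt_top.ne (hx.trans_eq eLpNorm_exponent_top.symm)
  rw [toReal_enorm] at h1
  refine le_trans (le_of_eq ?_) h1
  exact (LinearIsometryEquiv.norm_map (InnerProductSpace.toDual ℝ _).symm _).symm

/-- On `Γ` the perturbation has pointwise Lipschitz constant at most `‖∇ζ‖_{L^∞(Γ)}`: near a point
it coincides with one of the `C¹` functions whose piece accumulates there, and the gradients of
these are bounded up to the interfaces between the pieces. -/
theorem eventually_abs_sub_le (hΓ : IsOpen Γ) (hζ : IsPerturbation Γ ζ)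
    {x : EuclideanSpace ℝ (Fin n)} (hx : x ∈ Γ) {ε : ℝ} (hε : 0 < ε) :
    ∀ᶠ y in 𝓝 x, |ζ y - ζ x| ≤ (gradNorm Γ ζ + ε) * ‖y - x‖ := by
  obtain ⟨k, U, f, hU, -, hnull, hf⟩ := hζ.piecewise
  have hcover (y : EuclideanSpace ℝ (Fin n)) (hy : y ∈ Γ) : ∃ j, y ∈ closure (U j) := by
    by_contra! hn
    have hopen : IsOpen (Γ \ ⋃ j, closure (U j)) :=
      hΓ.sdiff (isClosed_iUnion_of_finite fun _ => isClosed_closure)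
    have hempty := (hopen.measure_eq_zero_iff volume).1 (measure_mono_null
      (sdiff_subset_sdiff_right (iUnion_mono fun j => subset_closure)) hnull)
    have hmem : y ∈ Γ \ ⋃ j, closure (U j) := ⟨hy, by simpa using hn⟩
    rw [hempty] at hmem
    exact hmem
  have heq (j : Fin k) : EqOn ζ (f j) (closure (U j) ∩ Γ) :=
    (hf j).2.of_subset_closure (hζ.continuousOn.mono (inter_subset_right.trans subset_closure))
      ((hf j).1.continuousOn.mono inter_subset_right)
      (subset_inter subset_closure (hU j).2) inter_subset_left
  have hgrad (j : Fin k) (hxj : x ∈ closure (U j)) : ‖fderiv ℝ (f j) x‖ ≤ gradNorm Γ ζ := by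
    by_contra! hn
    have hopen : IsOpen (Γ ∩ (fun y => ‖fderiv ℝ (f j) y‖) ⁻¹' Ioi (gradNorm Γ ζ)) :=
      ((hf j).1.continuousOn_fderiv_of_isOpen hΓ le_rfl).norm.isOpen_inter_preimage hΓ isOpen_Ioi
    obtain ⟨y, hyV, hyU⟩ := mem_closure_iff.1 hxj _ hopen ⟨hx, hn⟩
    -- Otherwise the bound on the gradient of `ζ` would fail on a nonempty open subset of `U j`.
    have hne : volume (Γ ∩ (fun y => ‖fderiv ℝ (f j) y‖) ⁻¹' Ioi (gradNorm Γ ζ) ∩ U j) ≠ 0 :=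
      ((hopen.inter (hU j).1).measure_pos volume ⟨y, hyV, hyU⟩).ne'
    refine hne (measure_mono_null ?_
      ((ae_restrict_iff' hΓ.measurableSet).1 (ae_norm_fderiv_le_gradNorm hζ)))
    rintro z ⟨⟨hzΓ, hz⟩, hzU⟩ hle
    have hzeq : fderiv ℝ ζ z = fderiv ℝ (f j) z :=
      ((hf j).2.eventuallyEq_of_mem ((hU j).1.mem_nhds hzU)).fderiv_eq
    have := hle hzΓ
    rw [hzeq] at this
    exact (not_lt.2 this) hz
  have hall : ∀ᶠ y in 𝓝 x, ∀ j, y ∈ closure (U j) → y ∈ Γ →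
      |ζ y - ζ x| ≤ (gradNorm Γ ζ + ε) * ‖y - x‖ := by
    refine eventually_all.2 fun j => ?_
    by_cases hxj : x ∈ closure (U j)
    · have hd : HasFDerivAt (f j) (fderiv ℝ (f j) x) x :=
        (((hf j).1.differentiableOn one_ne_zero).differentiableAt (hΓ.mem_nhds hx)).hasFDerivAt
      filter_upwards [hd.isLittleO.def hε] with y hy hyj hyΓ
      rw [heq j ⟨hyj, hyΓ⟩, heq j ⟨hxj, hx⟩]
      calc |f j y - f j x| = ‖(f j y - f j x - fderiv ℝ (f j) x (y - x))
              + fderiv ℝ (f j) x (y - x)‖ := by rw [sub_add_cancel, Real.norm_eq_abs]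
        _ ≤ ε * ‖y - x‖ + gradNorm Γ ζ * ‖y - x‖ :=
          (norm_add_le _ _).trans (add_le_add hy
            ((fderiv ℝ (f j) x).le_of_opNorm_le (hgrad j hxj) _))
        _ = (gradNorm Γ ζ + ε) * ‖y - x‖ := by ring
    · filter_upwards [isClosed_closure.isOpen_compl.mem_nhds hxj] with y hy hyj
      exact absurd hyj hy
  filter_upwards [hall, hΓ.mem_nhds hx] with y hy hyΓ
  obtain ⟨j, hj⟩ := hcover y hyΓ
  exact hy j hj hyΓ

/-- The extension of the perturbation by zero to all of `ℝ^(N-1)`. -/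
noncomputable def zeroExt (Γ : Set (EuclideanSpace ℝ (Fin n))) (ζ : EuclideanSpace ℝ (Fin n) → ℝ) :
    EuclideanSpace ℝ (Fin n) → ℝ :=
  Γ.indicator ζ

theorem continuous_zeroExt (hζ : IsPerturbation Γ ζ) : Continuous (zeroExt Γ ζ) :=
  continuous_indicator hζ.eq_zero hζ.continuousOn

theorem zeroExt_eventuallyEq (hΓ : IsOpen Γ) {x : EuclideanSpace ℝ (Fin n)} (hx : x ∈ Γ) :
    zeroExt Γ ζ =ᶠ[𝓝 x] ζ := by
  filter_upwards [hΓ.mem_nhds hx] with y hy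
  exact indicator_of_mem hy ζ

theorem lipschitzWith_zeroExt (hΓ : IsOpen Γ) (hζ : IsPerturbation Γ ζ) :
    LipschitzWith (gradNorm Γ ζ).toNNReal (zeroExt Γ ζ) := by
  refine LipschitzWith.of_dist_le_mul fun x y => ?_
  rw [Real.coe_toNNReal (gradNorm Γ ζ) ENNReal.toReal_nonneg, Real.dist_eq, dist_eq_norm]
  refine abs_sub_le_of_eq_zero_of_notMem hΓ ENNReal.toReal_nonneg (continuous_zeroExt hζ)
    (fun z hz => indicator_of_notMem hz ζ) (fun z hz ε hε => ?_) x y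
  filter_upwards [eventually_abs_sub_le hΓ hζ hz hε, zeroExt_eventuallyEq hΓ hz] with w hw hwe
  rwa [hwe, (zeroExt_eventuallyEq hΓ hz).self_of_nhds]

/-- Compactness of `closure Γ` makes the perturbation stay away from the top and bottom of the
cylinder. -/
theorem exists_abs_zeroExt_le (hΓb : Bornology.IsBounded Γ) (hζ : IsPerturbation Γ ζ) :
    ∃ s < 1, 0 ≤ s ∧ ∀ x, |zeroExt Γ ζ x| ≤ s := by
  have hlt (x : EuclideanSpace ℝ (Fin n)) : |zeroExt Γ ζ x| < 1 := by
    by_cases hx : x ∈ Γ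
    · rw [zeroExt, indicator_of_mem hx, abs_lt]
      exact (hζ.mem_cyl x hx).2
    · simp [zeroExt, indicator_of_notMem hx]
  rcases Γ.eq_empty_or_nonempty with rfl | hne
  · exact ⟨0, one_pos, le_rfl, by simp [zeroExt]⟩
  obtain ⟨x₀, -, hmax⟩ := hΓb.isCompact_closure.exists_isMaxOn hne.closure
    (continuous_zeroExt hζ).abs.continuousOn
  refine ⟨|zeroExt Γ ζ x₀|, hlt x₀, abs_nonneg _, fun x => ?_⟩
  by_cases hx : x ∈ Γ
  · exact hmax (subset_closure hx)
  · simp [zeroExt, indicator_of_notMem hx]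

theorem supNorm_le_and_ae_le_supNorm (hΓ : IsOpen Γ) {s : ℝ} (hs : 0 ≤ s)
    (hζs : ∀ x, |zeroExt Γ ζ x| ≤ s) :
    supNorm Γ ζ ≤ s ∧ ∀ᵐ x ∂(volume.restrict Γ), |ζ x| ≤ supNorm Γ ζ := by
  have hle : eLpNorm ζ ⊤ (volume.restrict Γ) ≤ ENNReal.ofReal s := by
    rw [eLpNorm_exponent_top]
    refine eLpNormEssSup_le_of_ae_bound ?_
    filter_upwards [ae_restrict_mem hΓ.measurableSet] with x hx
    have := hζs x
    rwa [zeroExt, indicator_of_mem hx] at this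
  refine ⟨ENNReal.toReal_le_of_le_ofReal hs hle, ?_⟩
  filter_upwards [ae_le_eLpNormEssSup (f := ζ) (μ := volume.restrict Γ)] with x hx
  have h1 := ENNReal.toReal_mono (hle.trans_lt ENNReal.ofReal_lt_top).ne
    (hx.trans_eq eLpNorm_exponent_top.symm)
  rwa [toReal_enorm] at h1

end Perturbation

/-! ### The hat function -/

/-- The hat function `z ↦ (1 - |z|)₊`. -/
noncomputable def tent (z : ℝ) : ℝ := max (1 - |z|) 0

/-- The derivative of `tent` off its three kinks `-1, 0, 1`. -/
noncomputable def tentDeriv (z : ℝ) : ℝ := if |z| < 1 then (if 0 < z then -1 else 1) else 0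

theorem tent_nonneg (z : ℝ) : 0 ≤ tent z := le_max_right _ _

theorem tent_le_one (z : ℝ) : tent z ≤ 1 := max_le (by linarith [abs_nonneg z]) zero_le_one

theorem tent_of_abs_le {z : ℝ} (hz : |z| ≤ 1) : tent z = 1 - |z| := max_eq_left (by linarith)

theorem tent_of_le_abs {z : ℝ} (hz : 1 ≤ |z|) : tent z = 0 := max_eq_right (by linarith)

theorem continuous_tent : Continuous tent := by
  unfold tent
  fun_prop

theorem abs_tent_sub_le (z w : ℝ) : |tent z - tent w| ≤ |z - w| := by
  refine (abs_max_sub_max_le_abs _ _ _).trans ?_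
  rw [sub_sub_sub_cancel_left, abs_sub_comm z w]
  exact abs_abs_sub_abs_le w z

theorem abs_tentDeriv_le (z : ℝ) : |tentDeriv z| ≤ 1 := by
  unfold tentDeriv
  split_ifs <;> simp

theorem measurable_tentDeriv : Measurable tentDeriv :=
  Measurable.ite (measurableSet_lt continuous_abs.measurable measurable_const)
    (Measurable.ite measurableSet_Ioi measurable_const measurable_const) measurable_const

theorem hasDerivAt_tent {z : ℝ} (hz : z ∉ ({-1, 0, 1} : Set ℝ)) :
    HasDerivAt tent (tentDeriv z) z := by
  simp only [mem_insert_iff, mem_singleton_iff, not_or] at hz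
  obtain ⟨h1, h2, h3⟩ := hz
  rcases lt_or_gt_of_ne h2 with h0 | h0
  · rcases lt_or_gt_of_ne h1 with h | h
    · have : tentDeriv z = 0 := by
        rw [tentDeriv, if_neg (by rw [abs_of_neg h0]; linarith)]
      rw [this]
      refine (hasDerivAt_const z (0 : ℝ)).congr_of_eventuallyEq ?_
      filter_upwards [gt_mem_nhds h] with w hw
      exact tent_of_le_abs (by rw [abs_of_neg (by linarith)]; linarith)
    · have : tentDeriv z = 1 := by
        rw [tentDeriv, if_pos (by rw [abs_of_neg h0]; linarith), if_neg h0.not_gt]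
      rw [this]
      refine ((hasDerivAt_id z).const_add 1).congr_of_eventuallyEq ?_
      filter_upwards [lt_mem_nhds h, gt_mem_nhds h0] with w hw hw0
      rw [tent_of_abs_le (by rw [abs_of_neg hw0]; linarith), abs_of_neg hw0, sub_neg_eq_add, id]
  · rcases lt_or_gt_of_ne h3 with h | h
    · have : tentDeriv z = -1 := by
        rw [tentDeriv, if_pos (by rwa [abs_of_pos h0]), if_pos h0]
      rw [this]
      refine ((hasDerivAt_id z).const_sub 1).congr_of_eventuallyEq ?_
      filter_upwards [gt_mem_nhds h, lt_mem_nhds h0] with w hw hw0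
      rw [tent_of_abs_le (by rw [abs_of_pos hw0]; linarith), abs_of_pos hw0, id]
    · have : tentDeriv z = 0 := by
        rw [tentDeriv, if_neg (by rw [abs_of_pos h0]; linarith)]
      rw [this]
      refine (hasDerivAt_const z (0 : ℝ)).congr_of_eventuallyEq ?_
      filter_upwards [lt_mem_nhds h] with w hw
      exact tent_of_le_abs (by rw [abs_of_pos (by linarith)]; linarith)

/-! ### The fibrewise map -/

/-- The piecewise affine map of the line that fixes everything outside `(-1, 1)` and moves `0`
to `e`. -/
noncomputable def fibreMap (e z : ℝ) : ℝ := z + tent z * e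

theorem continuous_fibreMap (e : ℝ) : Continuous (fibreMap e) := by
  unfold fibreMap
  exact continuous_id.add (continuous_tent.mul continuous_const)

theorem sub_mul_abs_le_fibreMap {e s : ℝ} (he : |e| ≤ s) (z w : ℝ) :
    (1 - s) * |z - w| ≤ |fibreMap e z - fibreMap e w| := by
  have h1 : z - w = fibreMap e z - fibreMap e w - (tent z - tent w) * e := by
    unfold fibreMap
    ring
  have h2 : |z - w| ≤ |fibreMap e z - fibreMap e w| + |(tent z - tent w) * e| := by
    conv_lhs => rw [h1]
    exact abs_sub _ _
  have h3 : |(tent z - tent w) * e| ≤ |z - w| * s := by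
    rw [abs_mul]
    exact mul_le_mul (abs_tent_sub_le z w) he (abs_nonneg _) (abs_nonneg _)
  linarith

theorem fibreMap_of_le_abs {e z : ℝ} (hz : 1 ≤ |z|) : fibreMap e z = z := by
  rw [fibreMap, tent_of_le_abs hz, zero_mul, add_zero]

theorem abs_fibreMap_lt_one_iff {e : ℝ} (he : |e| < 1) (z : ℝ) : |fibreMap e z| < 1 ↔ |z| < 1 := by
  refine ⟨fun h => ?_, fun h => ?_⟩
  · by_contra! hz
    rw [fibreMap_of_le_abs hz] at h
    exact h.not_ge hz
  · rw [fibreMap, tent_of_abs_le h.le]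
    calc |z + (1 - |z|) * e| ≤ |z| + |(1 - |z|) * e| := abs_add_le _ _
      _ = |z| + (1 - |z|) * |e| := by rw [abs_mul, abs_of_pos (sub_pos.2 h)]
      _ < |z| + (1 - |z|) * 1 :=
        add_lt_add_right (mul_lt_mul_of_pos_left he (sub_pos.2 h)) _
      _ = 1 := by ring

theorem bijective_fibreMap {e : ℝ} (he : |e| < 1) : Function.Bijective (fibreMap e) := by
  refine ⟨fun z w hzw => ?_, fun y => ?_⟩
  · have h := sub_mul_abs_le_fibreMap le_rfl (e := e) z w
    rw [hzw, sub_self, abs_zero] at h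
    have h0 : |z - w| ≤ 0 := nonpos_of_mul_nonpos_right h (sub_pos.2 he)
    exact sub_eq_zero.1 (abs_nonpos_iff.1 h0)
  · by_cases hy : 1 ≤ |y|
    · exact ⟨y, fibreMap_of_le_abs hy⟩
    · have h := intermediate_value_Icc (by norm_num : (-1 : ℝ) ≤ 1)
        (continuous_fibreMap e).continuousOn
      rw [fibreMap_of_le_abs (by simp), fibreMap_of_le_abs (by simp)] at h
      obtain ⟨z, -, hz⟩ := h (abs_le.1 (not_le.1 hy).le)
      exact ⟨z, hz⟩

theorem one_add_tentDeriv_mul_mem {e s : ℝ} (he : |e| ≤ s) (z : ℝ) :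
    1 + tentDeriv z * e ∈ Icc (1 - s) (1 + s) := by
  have h : |tentDeriv z * e| ≤ s := by
    rw [abs_mul]
    exact (mul_le_of_le_one_left (abs_nonneg e) (abs_tentDeriv_le z)).trans he
  have := abs_le.1 h
  constructor <;> linarith

/-- The change of variables `y = fibreMap e z`, applied off the kinks `-1, 0, 1`. -/
theorem lintegral_fibreMap {e : ℝ} (he : |e| < 1) (F : ℝ → ℝ≥0∞) :
    ∫⁻ z, F (fibreMap e z) * ENNReal.ofReal (1 + tentDeriv z * e) = ∫⁻ y, F y := by
  have hfin : ({-1, 0, 1} : Set ℝ).Finite := toFinite _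
  have hae {A : Set ℝ} (hA : A.Finite) : (Aᶜ : Set ℝ) =ᵐ[volume] (univ : Set ℝ) :=
    ae_eq_univ.2 (by rw [compl_compl]; exact hA.measure_zero volume)
  have hbij := bijective_fibreMap he
  rw [← setLIntegral_univ, ← setLIntegral_univ F, ← setLIntegral_congr (hae hfin),
    ← setLIntegral_congr (hae (hfin.image (fibreMap e))), ← image_compl_eq hbij,
    lintegral_image_eq_lintegral_abs_deriv_mul (f := fibreMap e) hfin.measurableSet.compl
      (fun z hz => ((hasDerivAt_id z).add ((hasDerivAt_tent hz).mul_const e)).hasDerivWithinAt)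
      hbij.1.injOn]
  refine lintegral_congr fun z => ?_
  have hpos : 0 < 1 + tentDeriv z * e := by
    linarith [(one_add_tentDeriv_mul_mem le_rfl z : _ ∈ Icc (1 - |e|) (1 + |e|)).1]
  rw [abs_of_pos hpos, mul_comm]

/-! ### The change of variables straightening the interface -/

section Straighten

variable {n : ℕ} {η : EuclideanSpace ℝ (Fin n) → ℝ} {M : ℝ≥0} {s : ℝ}

/-- The map `(x̃, z) ↦ (x̃, z + (1 - |z|)₊ η(x̃))`, which moves the flat interface `z = 0` to the
graph of `η`. On `Γ × (-1, 0)` and `Γ × (0, 1)` it equals `Λ_1⁻¹` and `Λ_2⁻¹`. -/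
noncomputable def unstraighten (η : EuclideanSpace ℝ (Fin n) → ℝ) (X : Space n) : Space n :=
  (X.1, fibreMap (η X.1) X.2)

/-- The Jacobian determinant of `unstraighten η`. -/
noncomputable def unstraightenJac (η : EuclideanSpace ℝ (Fin n) → ℝ) (X : Space n) : ℝ :=
  1 + tentDeriv X.2 * η X.1

theorem abs_fibreMap_sub_le_left (e e' z : ℝ) : |fibreMap e z - fibreMap e' z| ≤ |e - e'| := by
  rw [fibreMap, fibreMap, add_sub_add_left_eq_sub, ← mul_sub, abs_mul,
    abs_of_nonneg (tent_nonneg z)]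
  exact mul_le_of_le_one_left (abs_nonneg _) (tent_le_one z)

theorem lipschitzWith_unstraighten (hη : LipschitzWith M η) (hs : ∀ x, |η x| < 1) :
    LipschitzWith (2 + M) (unstraighten η) := by
  refine LipschitzWith.of_dist_le_mul fun X Y => ?_
  have h1 : dist X.1 Y.1 ≤ dist X Y := (le_max_left _ _).trans_eq Prod.dist_eq.symm
  have h2 : dist X.2 Y.2 ≤ dist X Y := (le_max_right _ _).trans_eq Prod.dist_eq.symm
  have hD : 0 ≤ dist X Y := dist_nonneg
  have hMD : 0 ≤ M * dist X Y := mul_nonneg M.2 hD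
  push_cast
  rw [Prod.dist_eq (x := unstraighten η X)]
  refine max_le ?_ ?_
  · show dist X.1 Y.1 ≤ _
    linarith
  · show dist (fibreMap (η X.1) X.2) (fibreMap (η Y.1) Y.2) ≤ _
    have h3 : |fibreMap (η X.1) X.2 - fibreMap (η X.1) Y.2| ≤ 2 * dist X.2 Y.2 := by
      have : fibreMap (η X.1) X.2 - fibreMap (η X.1) Y.2 =
          (X.2 - Y.2) + (tent X.2 - tent Y.2) * η X.1 := by
        unfold fibreMap
        ring
      rw [this, two_mul, Real.dist_eq]
      refine (abs_add_le _ _).trans (add_le_add_right ?_ _)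
      rw [abs_mul]
      exact (mul_le_of_le_one_right (abs_nonneg _) (hs X.1).le).trans (abs_tent_sub_le _ _)
    have h4 := (abs_fibreMap_sub_le_left (η X.1) (η Y.1) Y.2).trans (hη.dist_le_mul X.1 Y.1)
    have h5 := mul_le_mul_of_nonneg_left h1 M.2
    rw [Real.dist_eq]
    have h6 := abs_sub_le (fibreMap (η X.1) X.2) (fibreMap (η X.1) Y.2) (fibreMap (η Y.1) Y.2)
    linarith!

theorem antilipschitzWith_unstraighten (hη : LipschitzWith M η) (hs : s < 1)
    (hηs : ∀ x, |η x| ≤ s) :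
    AntilipschitzWith ((1 + M) / (1 - s).toNNReal) (unstraighten η) := by
  refine AntilipschitzWith.of_le_mul_dist fun X Y => ?_
  have hs0 : 0 ≤ s := (abs_nonneg _).trans (hηs 0)
  have h1 : dist X.1 Y.1 ≤ dist (unstraighten η X) (unstraighten η Y) :=
    le_max_left (dist (unstraighten η X).1 (unstraighten η Y).1) _
  have h2 : |fibreMap (η X.1) X.2 - fibreMap (η Y.1) Y.2| ≤
      dist (unstraighten η X) (unstraighten η Y) :=
    le_max_right _ (dist (unstraighten η X).2 (unstraighten η Y).2)
  set D := dist (unstraighten η X) (unstraighten η Y)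
  have hMD := mul_le_mul_of_nonneg_left h1 M.2
  have hD : 0 ≤ D := dist_nonneg
  have hMD0 : 0 ≤ (M : ℝ) * D := mul_nonneg M.2 hD
  push_cast
  rw [Real.coe_toNNReal _ (sub_pos.2 hs).le, div_mul_eq_mul_div, le_div_iff₀ (sub_pos.2 hs),
    Prod.dist_eq, mul_comm, mul_max_of_nonneg _ _ (sub_pos.2 hs).le]
  refine max_le ?_ ?_
  · have : (1 - s) * dist X.1 Y.1 ≤ dist X.1 Y.1 :=
      mul_le_of_le_one_left dist_nonneg (by linarith)
    linarith
  · have h3 := sub_mul_abs_le_fibreMap (hηs X.1) X.2 Y.2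
    have h4 := abs_sub_le (fibreMap (η X.1) X.2) (fibreMap (η Y.1) Y.2) (fibreMap (η X.1) Y.2)
    have h5 := (abs_fibreMap_sub_le_left (η Y.1) (η X.1) Y.2).trans (hη.dist_le_mul Y.1 X.1)
    rw [dist_comm Y.1] at h5
    rw [Real.dist_eq]
    linarith!

theorem surjective_unstraighten (hηs : ∀ x, |η x| < 1) : Function.Surjective (unstraighten η) := by
  rintro ⟨x, y⟩
  obtain ⟨z, hz⟩ := (bijective_fibreMap (hηs x)).2 y
  exact ⟨(x, z), Prod.ext rfl hz⟩

theorem exists_homeomorph_unstraighten (hη : LipschitzWith M η) (hs : s < 1)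
    (hηs : ∀ x, |η x| ≤ s) : ∃ Φ : Space n ≃ₜ Space n, ⇑Φ = unstraighten η := by
  have hlt (x : EuclideanSpace ℝ (Fin n)) : |η x| < 1 := (hηs x).trans_lt hs
  have hanti := antilipschitzWith_unstraighten hη hs hηs
  exact ⟨(Equiv.ofBijective _
    ⟨hanti.injective, surjective_unstraighten hlt⟩).toHomeomorphOfIsInducing
      (hanti.isInducing (lipschitzWith_unstraighten hη hlt).continuous), rfl⟩

theorem isBilipschitzChange_unstraighten {Γ : Set (EuclideanSpace ℝ (Fin n))}
    (hη : LipschitzWith M η) (hs : s < 1) (hηs : ∀ x, |η x| ≤ s) {Φ : Space n ≃ₜ Space n}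
    (hΦ : ⇑Φ = unstraighten η) : IsBilipschitzChange (cyl Γ) Φ (unstraightenJac η) := by
  have hlt (x : EuclideanSpace ℝ (Fin n)) : |η x| < 1 := (hηs x).trans_lt hs
  have hm : Measurable (unstraightenJac η) :=
    measurable_const.add ((measurable_tentDeriv.comp measurable_snd).mul
      (hη.continuous.measurable.comp measurable_fst))
  refine ⟨⟨_, hΦ ▸ lipschitzWith_unstraighten hη hlt⟩,
    ⟨_, (hΦ ▸ antilipschitzWith_unstraighten hη hs hηs).to_rightInverse Φ.apply_symm_apply⟩,
    fun X => ?_, hm, ⟨1 - s, sub_pos.2 hs, fun X => (one_add_tentDeriv_mul_mem (hηs X.1) X.2).1⟩,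
    ⟨1 + s, fun X => (one_add_tentDeriv_mul_mem (hηs X.1) X.2).2⟩, fun G hG => ?_⟩
  · rw [hΦ]
    refine and_congr_right fun _ => ?_
    rw [mem_Ioo, mem_Ioo, ← abs_lt, ← abs_lt]
    exact abs_fibreMap_lt_one_iff (hlt X.1) X.2
  · have hGm : Measurable fun X => G (unstraighten η X) * ENNReal.ofReal (unstraightenJac η X) :=
      (hG.comp (hΦ ▸ Φ.continuous.measurable)).mul hm.ennreal_ofReal
    rw [hΦ, Measure.volume_eq_prod, lintegral_prod _ hGm.aemeasurable,
      lintegral_prod _ hG.aemeasurable]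
    exact lintegral_congr fun x => lintegral_fibreMap (hlt x) fun y => G (x, y)

theorem hasFDerivAt_unstraighten {X : Space n} {L : EuclideanSpace ℝ (Fin n) →L[ℝ] ℝ}
    (hη : HasFDerivAt η L X.1) (hX : X.2 ∉ ({-1, 0, 1} : Set ℝ)) :
    HasFDerivAt (unstraighten η)
      ((ContinuousLinearMap.fst ℝ _ ℝ).prod
        (ContinuousLinearMap.snd ℝ (EuclideanSpace ℝ (Fin n)) ℝ +
          (tent X.2 • L.comp (ContinuousLinearMap.fst ℝ _ ℝ) +
            η X.1 • tentDeriv X.2 • ContinuousLinearMap.snd ℝ _ ℝ))) X := by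
  refine hasFDerivAt_fst.prodMk (hasFDerivAt_snd.add ?_)
  exact ((hasDerivAt_tent hX).comp_hasFDerivAt X hasFDerivAt_snd).mul
    (hη.comp X hasFDerivAt_fst)

theorem sum_apply_single_sq (L : EuclideanSpace ℝ (Fin n) →L[ℝ] ℝ) :
    ∑ i, L (EuclideanSpace.single i 1) ^ 2 = ‖L‖ ^ 2 := by
  rw [← (InnerProductSpace.toDual ℝ _).symm.norm_map L, EuclideanSpace.norm_sq_eq]
  refine Finset.sum_congr rfl fun i _ => ?_
  rw [Real.norm_eq_abs, sq_abs, ← InnerProductSpace.toDual_symm_apply,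
    EuclideanSpace.inner_single_right]
  simp

/-- The transformed gradient against the Jacobian determinant `d ∈ [1 - s, 1 + s]`: besides
`(a + b)² ≤ 2a² + 2b²` in the horizontal directions, the vertical term is `d² ≤ (1 + s) d`, and
`1 + s = (1 - s²) / (1 - s)`. -/
theorem sum_sq_jacEntry_unstraighten_le {X : Space n} (hη : DifferentiableAt ℝ η X.1)
    (hX : X.2 ∉ ({-1, 0, 1} : Set ℝ)) (hs : s < 1) (hηs : |η X.1| ≤ s) {m A : ℝ}
    (hm : ‖fderiv ℝ η X.1‖ ≤ m) (hA : 2 ≤ A) (hmA : 2 * m ^ 2 + (1 - s ^ 2) ≤ A)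
    (c : Fin (n + 1) → ℝ) :
    ∑ l, (∑ k, c k * jacEntry (unstraighten η) k l X) ^ 2 ≤
      A / (1 - s) * unstraightenJac η X * ∑ k, c k ^ 2 := by
  set L := fderiv ℝ η X.1
  set d := unstraightenJac η X with hd
  have hfd := (hasFDerivAt_unstraighten hη.hasFDerivAt hX).fderiv
  have hlast : ∑ k, c k * jacEntry (unstraighten η) k (Fin.last n) X = c (Fin.last n) * d := by
    rw [Fin.sum_univ_castSucc]
    simp [jacEntry, hfd, hd, unstraightenJac, mul_comm]
  have hcast (i : Fin n) : ∑ k, c k * jacEntry (unstraighten η) k i.castSucc X =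
      c i.castSucc + c (Fin.last n) * (tent X.2 * L (EuclideanSpace.single i 1)) := by
    rw [Fin.sum_univ_castSucc]
    simp [jacEntry, hfd, L]
  obtain ⟨hd1, hd2⟩ : d ∈ Icc (1 - s) (1 + s) := one_add_tentDeriv_mul_mem hηs X.2
  have hs1 : 0 < 1 - s := sub_pos.2 hs
  have hd0 : 0 < d := hs1.trans_le hd1
  set S := ∑ i : Fin n, c i.castSucc ^ 2
  set b := c (Fin.last n)
  have hS : 0 ≤ S := Finset.sum_nonneg fun _ _ => sq_nonneg _
  have hLm : ‖L‖ ^ 2 ≤ m ^ 2 := pow_le_pow_left₀ (norm_nonneg _) hm 2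
  have hhor : ∑ i : Fin n, (c i.castSucc + b * (tent X.2 * L (EuclideanSpace.single i 1))) ^ 2 ≤
      2 * S + 2 * b ^ 2 * m ^ 2 :=
    calc _ ≤ ∑ i : Fin n, (2 * c i.castSucc ^ 2 +
            2 * b ^ 2 * L (EuclideanSpace.single i 1) ^ 2) := by
          refine Finset.sum_le_sum fun i _ => ?_
          have h1 : (tent X.2 * L (EuclideanSpace.single i 1)) ^ 2 ≤
              L (EuclideanSpace.single i 1) ^ 2 := by
            rw [mul_pow]
            exact mul_le_of_le_one_left (sq_nonneg _)
              (pow_le_one₀ (tent_nonneg _) (tent_le_one _))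
          have h2 := mul_le_mul_of_nonneg_left h1 (sq_nonneg b)
          linarith [sq_nonneg (c i.castSucc - b * (tent X.2 * L (EuclideanSpace.single i 1)))]
      _ = 2 * S + 2 * b ^ 2 * ‖L‖ ^ 2 := by
          rw [Finset.sum_add_distrib, ← Finset.mul_sum, ← Finset.mul_sum, sum_apply_single_sq]
      _ ≤ _ := by
          have := mul_le_mul_of_nonneg_left hLm (sq_nonneg b)
          linarith
  have hcoef : 2 * m ^ 2 + d ^ 2 ≤ A / (1 - s) * d := by
    rw [div_mul_eq_mul_div, le_div_iff₀ hs1]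
    have h1 : 2 * m ^ 2 * (1 - s) ≤ 2 * m ^ 2 * d := mul_le_mul_of_nonneg_left hd1 (by positivity)
    have h2 : d * (d * (1 - s)) ≤ d * ((1 + s) * (1 - s)) :=
      mul_le_mul_of_nonneg_left (mul_le_mul_of_nonneg_right hd2 hs1.le) hd0.le
    have h3 := mul_le_mul_of_nonneg_right hmA hd0.le
    linarith
  have hcoef2 : 2 ≤ A / (1 - s) * d := by
    rw [div_mul_eq_mul_div, le_div_iff₀ hs1]
    nlinarith
  rw [Fin.sum_univ_castSucc, hlast]
  simp only [hcast]
  rw [Fin.sum_univ_castSucc]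
  have h1 := mul_le_mul_of_nonneg_right hcoef (sq_nonneg b)
  have h2 := mul_le_mul_of_nonneg_right hcoef2 hS
  linarith

end Straighten

section FracMap

variable {n : ℕ} {Γ : Set (EuclideanSpace ℝ (Fin n))} {ζ : EuclideanSpace ℝ (Fin n) → ℝ}

theorem isOpen_cyl (hΓ : IsOpen Γ) : IsOpen (cyl Γ) := hΓ.prod isOpen_Ioo

theorem fracMap_eq_comp_unstraighten {X : Space n} (hX : X ∈ cyl Γ) (hX0 : X.2 ≠ 0)
    (f : Space n → ℝ) : fracMap Γ ζ f X = f (unstraighten (zeroExt Γ ζ) X) := by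
  have hz : |X.2| ≤ 1 := (abs_lt.2 hX.2).le
  rw [unstraighten, fibreMap, zeroExt, indicator_of_mem hX.1, tent_of_abs_le hz, fracMap,
    Finset.sum_pair (by norm_num)]
  rcases lt_or_gt_of_ne hX0 with h | h
  · rw [indicator_of_mem (show X ∈ flatDomain Γ 1 from ⟨hX, by linarith⟩),
      indicator_of_notMem (show X ∉ flatDomain Γ 2 from fun h' => by
        have := h'.2
        norm_num at this
        linarith), add_zero, abs_of_neg h, Function.comp_apply, LamInv]
    congr 2
    ring
  · rw [indicator_of_mem (show X ∈ flatDomain Γ 2 from ⟨hX, by norm_num; linarith⟩),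
      indicator_of_notMem (show X ∉ flatDomain Γ 1 from fun h' => by
        have := h'.2
        norm_num at this
        linarith), zero_add, abs_of_pos h, Function.comp_apply, LamInv]
    congr 2
    ring

theorem ae_cyl_snd_ne_zero : ∀ᵐ X ∂(volume.restrict (cyl Γ)), X.2 ≠ 0 :=
  ae_restrict_of_ae (Measure.quasiMeasurePreserving_snd.ae (volume.ae_ne 0))

theorem ae_cyl_of_ae {p : EuclideanSpace ℝ (Fin n) → Prop} (h : ∀ᵐ x ∂(volume.restrict Γ), p x) :
    ∀ᵐ X ∂(volume.restrict (cyl Γ)), p X.1 := by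
  rw [cyl, Measure.volume_eq_prod, ← Measure.prod_restrict]
  exact Measure.quasiMeasurePreserving_fst.ae h

end FracMap

end FractionalMapping

open FractionalMapping
theorem mainTheorem5 {n : ℕ} (Γ : Set (EuclideanSpace ℝ (Fin n)))
    (hΓ_open : IsOpen Γ) (hΓ_conn : IsConnected Γ) (hΓ_bdd : Bornology.IsBounded Γ)
    (ζ : EuclideanSpace ℝ (Fin n) → ℝ) (hζ : IsPerturbation Γ ζ) :
    supNorm Γ ζ < 1 ∧
    ∃ T : H1 (cyl Γ) ≃L[ℝ] H1 (cyl Γ),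
      (∀ (r : H1 (cyl Γ)) (f : Space n → ℝ), f =ᵐ[volume.restrict (cyl Γ)] H1.fn r →
        H1.fn (T r) =ᵐ[volume.restrict (cyl Γ)] fracMap Γ ζ f) ∧
      ∀ r : H1 (cyl Γ), ‖T r‖ ≤ Cζ Γ ζ / √(1 - supNorm Γ ζ) * ‖r‖ := by
  obtain ⟨s, hs1, hs0, hζs⟩ := exists_abs_zeroExt_le hΓ_bdd hζ
  obtain ⟨hsup, hae⟩ := supNorm_le_and_ae_le_supNorm hΓ_open hs0 hζs
  have hsup1 : supNorm Γ ζ < 1 := hsup.trans_lt hs1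
  have hsup0 : 0 ≤ supNorm Γ ζ := ENNReal.toReal_nonneg
  have hlip := lipschitzWith_zeroExt hΓ_open hζ
  obtain ⟨Φ, hΦ⟩ := exists_homeomorph_unstraighten hlip hs1 hζs
  have hcyl : IsOpen (cyl Γ) := isOpen_cyl hΓ_open
  have hchange := isBilipschitzChange_unstraighten (Γ := Γ) hlip hs1 hζs hΦ
  obtain ⟨T, hT⟩ := hchange.exists_continuousLinearEquiv hcyl
  refine ⟨hsup1, T, fun r f hf => ?_, fun r => ?_⟩
  · filter_upwards [(hT r).1, (hchange.quasiMeasurePreserving hcyl).ae hf,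
      ae_restrict_mem hcyl.measurableSet, ae_cyl_snd_ne_zero] with X h1 h2 h3 h4
    rw [h1, ← h2, fracMap_eq_comp_unstraighten h3 h4, hΦ]
  · set A : ℝ := max 2 (4 * W1infNorm Γ ζ ^ 2) with hA
    have hA2 : 2 ≤ A := le_max_left _ _
    have hgrad : 0 ≤ gradNorm Γ ζ := ENNReal.toReal_nonneg
    have hmA : 2 * gradNorm Γ ζ ^ 2 + (1 - supNorm Γ ζ ^ 2) ≤ A := by
      rcases le_total (2 * gradNorm Γ ζ ^ 2) 1 with h | h
      · linarith [sq_nonneg (supNorm Γ ζ)]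
      · have h1 : gradNorm Γ ζ ^ 2 ≤ W1infNorm Γ ζ ^ 2 :=
          pow_le_pow_left₀ hgrad (le_add_of_nonneg_left hsup0) 2
        have h2 : 4 * W1infNorm Γ ζ ^ 2 ≤ A := le_max_right _ _
        linarith [sq_nonneg (supNorm Γ ζ)]
    have hden : 0 < 1 - supNorm Γ ζ := sub_pos.2 hsup1
    have hdiff : ∀ᵐ x ∂(volume.restrict Γ), DifferentiableAt ℝ (zeroExt Γ ζ) x :=
      ae_restrict_of_ae hlip.ae_differentiableAt
    have hB : ‖T r‖ ^ 2 ≤ A / (1 - supNorm Γ ζ) * ‖r‖ ^ 2 := by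
      refine hchange.norm_sq_le_of_isComp hcyl (hT r) (by positivity) ?_
      filter_upwards [ae_restrict_mem hcyl.measurableSet, ae_cyl_snd_ne_zero, ae_cyl_of_ae hae,
        ae_cyl_of_ae (ae_norm_fderiv_le_gradNorm hζ), ae_cyl_of_ae hdiff] with X hX hX0 hXs hXm hXd
      have hXeq := zeroExt_eventuallyEq (ζ := ζ) hΓ_open hX.1
      have hXs' : |zeroExt Γ ζ X.1| ≤ supNorm Γ ζ := by rwa [hXeq.self_of_nhds]
      have hkink : X.2 ∉ ({-1, 0, 1} : Set ℝ) := by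
        simp only [mem_insert_iff, mem_singleton_iff, not_or]
        exact ⟨hX.2.1.ne', hX0, hX.2.2.ne⟩
      refine ⟨?_, fun c => ?_⟩
      · rw [div_mul_eq_mul_div, le_div_iff₀ hden]
        have h1 : 1 - supNorm Γ ζ ≤ unstraightenJac (zeroExt Γ ζ) X :=
          (one_add_tentDeriv_mul_mem hXs' X.2).1
        nlinarith
      · rw [hΦ]
        exact sum_sq_jacEntry_unstraighten_le hXd hkink hsup1 hXs'
          (by rwa [hXeq.fderiv_eq]) hA2 hmA c
    rw [← abs_of_nonneg (norm_nonneg (T r))]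
    refine (Real.abs_le_sqrt hB).trans_eq ?_
    rw [Real.sqrt_mul (by positivity), Real.sqrt_sq (norm_nonneg r), Real.sqrt_div (by positivity),
      Cζ]
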